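/- Let $\mathcal C\subset\mathbb R^n$ be a nonempty bounded convex open set whose boundary $\partial\mathcal C$ is a hypersurface of class $C^2$ with nowhere vanishing Gauss curvature. Then there is a constant $\alpha=\alpha(\mathcal C)>0$ such that every ideal triangle of the Hilbert geometry $(\mathcal C,d_{\mathcal C})$ has Hilbert area at most $\alpha$. Here an ideal triangle of $(\mathcal C,d_{\mathcal C})$ is the relative interior $T$ of the convex hull of three non-collinear points $a,b,c\in\partial\mathcal C$ such that $T\subset\mathcal C$. Its Hilbert area is $\mu_{\mathcal C\cap P}(T)$, where $P$ is the affine plane containing $a,b,c$ and $\mu_{\mathcal D}$ denotes the Hilbert measure of a bounded convex open subset $\mathcal D\neq\emptyset$ of a Euclidean plane, defined as follows. For $p\in\mathcal D$ and a nonzero vector $v$ of the direction of the plane, the line through $p$ directed by $v$ meets $\partial\mathcal D$ in two points $p^-$ and $p^+$, and one puts $$F_{\mathcal D}(p,v)=\tfrac12\|v\|\left(\frac1{\|p-p^-\|}+\frac1{\|p-p^+\|}\right),\qquad F_{\mathcal D}(p,0)=0 ;$$ then, with $B_{\mathcal D}(p)=\{v : F_{\mathcal D}(p,v)<1\}$,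 $$\mu_{\mathcal D}(A)=\int_A\frac{\pi}{\operatorname{vol}(B_{\mathcal D}(p))}\,d\operatorname{vol}(p)$$ for every Borel set $A\subset\mathcal D$, where $\operatorname{vol}$ is the two-dimensional Lebesgue measure. -/

import Mathlib

open MeasureTheory

noncomputable section

namespace HilbertGeometry

section Hypersurface

variable {E : Type*} [NormedAddCommGroup E] [InnerProductSpace ℝ E] [FiniteDimensional ℝ E]

/-- `f` is a regular equation of class `C²` of the set `S` on the open neighbourhood `U` of `p`. -/
structure IsLocalEquation (S : Set E) (p : E) (U : Set E) (f : E → ℝ) : Prop where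
  isOpen : IsOpen U
  mem : p ∈ U
  contDiffOn : ContDiffOn ℝ 2 f U
  gradient_ne_zero : ∀ x ∈ U, gradient f x ≠ 0
  inter_eq : S ∩ U = {x ∈ U | f x = 0}

/-- `S` is a hypersurface of class `C²` of the Euclidean space `E`. -/
def IsC2Hypersurface (S : Set E) : Prop :=
  ∀ p ∈ S, ∃ (U : Set E) (f : E → ℝ), IsLocalEquation S p U f

/-- The unit normal vector field (Gauss map) of the level sets of `f`. -/
def unitNormal (f : E → ℝ) (x : E) : E :=
  ‖gradient f x‖⁻¹ • gradient f x

/-- The tangent space at `p` of the level set of `f` through `p`. -/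
def tangentSpace (f : E → ℝ) (p : E) : Submodule ℝ E :=
  LinearMap.ker (fderiv ℝ f p : E →ₗ[ℝ] ℝ)

/-- The shape operator (Weingarten map) at `p` of the level set of `f` through `p`: minus the
differential of the Gauss map, as an endomorphism of the tangent space. (That differential takes
its values in the tangent space, so the orthogonal projection only serves to restrict the
codomain.) -/
def shapeOperator (f : E → ℝ) (p : E) : tangentSpace f p →ₗ[ℝ] tangentSpace f p :=
  ((tangentSpace f p).orthogonalProjectionOnto : E →ₗ[ℝ] tangentSpace f p) ∘ₗ
    (-(fderiv ℝ (unitNormal f) p : E →ₗ[ℝ] E)) ∘ₗ (tangentSpace f p).subtype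

/-- The Gauss(–Kronecker) curvature at `p` of the level set of `f` through `p`, oriented by the
gradient of `f`: the determinant of the shape operator. -/
def gaussCurvature (f : E → ℝ) (p : E) : ℝ :=
  LinearMap.det (shapeOperator f p)

/-- A convex domain: a nonempty bounded convex open set. -/
structure IsConvexDomain (C : Set E) : Prop where
  isOpen : IsOpen C
  nonempty : C.Nonempty
  convex : Convex ℝ C
  isBounded : Bornology.IsBounded C

/-- A strictly convex domain: a convex domain whose boundary is a hypersurface of class `C²` with
nowhere vanishing Gauss curvature. (Changing the local equation changes the curvature by a sign
at most, so its vanishing depends on the hypersurface only.) -/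
structure IsStrictlyConvexDomain (C : Set E) : Prop extends IsConvexDomain C where
  isC2Hypersurface : IsC2Hypersurface (frontier C)
  gaussCurvature_ne_zero : ∀ p ∈ frontier C, ∀ (U : Set E) (f : E → ℝ),
    IsLocalEquation (frontier C) p U f → gaussCurvature f p ≠ 0

end Hypersurface

section Finsler

variable {E : Type*} [NormedAddCommGroup E] [InnerProductSpace ℝ E]

/-- The point at which the half-line from `p ∈ C` with direction `v ≠ 0` leaves the bounded convex
open set `C`. -/
def exitPoint (C : Set E) (p v : E) : E :=
  p + sSup {t : ℝ | p + t • v ∈ C} • v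

/-- The Finsler metric of the Hilbert geometry of `C`. -/
def finsler (C : Set E) (p v : E) : ℝ :=
  1 / 2 * ‖v‖ * (1 / ‖p - exitPoint C p (-v)‖ + 1 / ‖p - exitPoint C p v‖)

/-- The open unit ball of the norm `finsler C p` on the tangent space at `p`. -/
def unitBall (C : Set E) (p : E) : Set E :=
  {v : E | finsler C p v < 1}

variable [FiniteDimensional ℝ E] [MeasurableSpace E] [BorelSpace E]

/-- The density of the Hilbert measure: the Lebesgue volume of the Euclidean unit ball divided by
that of the unit ball of the Finsler metric. -/
def density (C : Set E) (p : E) : ENNReal :=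
  (volume : Measure E) (Metric.ball 0 1) / (volume : Measure E) (unitBall C p)

/-- The Hilbert measure of a convex domain `C`, a measure carried by `C`. -/
def hilbertMeasure (C : Set E) : Measure E :=
  ((volume : Measure E).restrict C).withDensity (density C)

end Finsler

section Triangle

variable {E : Type*} [NormedAddCommGroup E] [InnerProductSpace ℝ E]

/-- The open triangle `abc`: the relative interior of the convex hull of `a`, `b`, `c`. -/
def openTriangle (a b c : E) : Set E :=
  {x : E | ∃ r s t : ℝ, 0 < r ∧ 0 < s ∧ 0 < t ∧ r + s + t = 1 ∧ x = r • a + s • b + t • c}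

/-- The triangle `abc` is an ideal triangle of the Hilbert geometry of `C`. -/
structure IsIdealTriangle (C : Set E) (a b c : E) : Prop where
  affineIndependent : AffineIndependent ℝ ![a, b, c]
  mem_frontier₁ : a ∈ frontier C
  mem_frontier₂ : b ∈ frontier C
  mem_frontier₃ : c ∈ frontier C
  subset : openTriangle a b c ⊆ C

/-- The trace of `A` on the affine plane through `a`, `b`, `c`, read in the direction of that plane
(a Euclidean vector plane) with `a` as origin. -/
def planeSection (a b c : E) (A : Set E) : Set (vectorSpan ℝ ({a, b, c} : Set E)) :=
  {v | a + (v : E) ∈ A}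

/-- The Hilbert area of the triangle `abc`: its Hilbert measure for the Hilbert geometry of the
intersection of `C` with the affine plane through `a`, `b`, `c`. -/
def triangleArea [FiniteDimensional ℝ E] [MeasurableSpace E] [BorelSpace E]
    (C : Set E) (a b c : E) : ENNReal :=
  hilbertMeasure (planeSection a b c C) (planeSection a b c (openTriangle a b c))

end Triangle

end HilbertGeometry

end

/-! Curvature enters through one uniform estimate, `IsStrictlyConvexDomain.exists_isPinched`: after
scaling, each boundary point `a` has a conormal `N` with `‖y - a‖² ≤ N (y - a)` on the closure of
`C`, and `K ‖y - a‖² < N (y - a)` forces `y ∈ C`. Locally, a boundary equation is altered so that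
its Hessian becomes negative definite; convexity and compactness then make the estimate global with
a single `K`.

Write a point of the triangle near the vertex `a` as `x = a + w`, `w = β (b - a) + γ (c - a)`, and
put `p = N (b - a)`, `q = N (c - a)`, `h = N w = β p + γ q`. Along `w` there is room of order `w` on
both sides of `x`. Along the tangential direction `τ = q (b - a) - p (c - a)`, whose norm the
pinching bounds by a multiple of `√(p q (p + q))`, there is room of order `√h` in length. The
Finsler unit ball at `x` therefore contains a parallelogram whose inverse area, in the coordinates
`(β, γ)`, is `144 K √(p q (p + q)) h ^ (-3/2)`: this is `IsPinched.exists_mem_symmetricPart`.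

That kernel is homogeneous of degree zero in `(p, q)`, and its integral over the unit square is at
most 6 whatever `p` and `q` are (`lintegral_cuspFun_le`), so the size and shape of the triangle play
no role. Hilbert area is affine invariant, so integrating in these coordinates is legitimate
(`hilbertMeasure_le_lintegral`). The three vertices together give the bound `π · 144 K · 18`. -/

open MeasureTheory Filter Topology Metric

namespace HilbertGeometry

/-! ### Second order calculus and quadratic forms -/

section Calculus

variable {E : Type*} [NormedAddCommGroup E] [NormedSpace ℝ E]

/-- A second order Taylor estimate which is uniform in the base point. -/
theorem exists_taylor_bound {f : E → ℝ} {p : E} (hf : ContDiffAt ℝ 2 f p) {ε : ℝ} (hε : 0 < ε) :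
    ∀ᶠ ρ in 𝓝[>] (0 : ℝ), ∀ a ∈ ball p ρ, ∀ y ∈ ball p ρ,
      |f y - f a - fderiv ℝ f a (y - a) - 1 / 2 * fderiv ℝ (fderiv ℝ f) p (y - a) (y - a)|
        ≤ ε * ‖y - a‖ ^ 2 := by
  set B := fderiv ℝ (fderiv ℝ f) p with hB
  have hsymm : ∀ v w, B v w = B w v := fun v w =>
    (hf.isSymmSndFDerivAt (by simp)) v w
  have hstrict : HasStrictFDerivAt (fderiv ℝ f) B p :=
    (hf.fderiv_right (m := 1) (by norm_num)).hasStrictFDerivAt (by norm_num)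
  have h1 := hstrict.isLittleO.def hε
  have h2 : ∀ᶠ z in 𝓝 p, DifferentiableAt ℝ f z := by
    filter_upwards [hf.eventually (by simp)] with z hz using hz.differentiableAt (by norm_num)
  obtain ⟨r₁, hr₁, h1⟩ := Metric.eventually_nhds_iff_ball.1 h1
  obtain ⟨r₂, hr₂, h2⟩ := Metric.eventually_nhds_iff_ball.1 h2
  filter_upwards [Ioo_mem_nhdsGT (lt_min hr₁ hr₂)] with ρ hρ a ha y hy
  have hρ₁ : ρ ≤ r₁ := hρ.2.le.trans (min_le_left _ _)
  have hρ₂ : ρ ≤ r₂ := hρ.2.le.trans (min_le_right _ _)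
  have hseg : segment ℝ a y ⊆ ball p ρ := (convex_ball p ρ).segment_subset ha hy
  -- Mean value inequality for `f` minus its quadratic model centred at `a`. Strict
  -- differentiability of `fderiv ℝ f` at `p` controls the pair `(z, a)` at once, whence the
  -- uniformity in `a`.
  have key := Convex.norm_image_sub_le_of_norm_hasFDerivWithin_le' (𝕜 := ℝ)
    (f := fun z => f z - 1 / 2 * B (z - a) (z - a)) (f' := fun z => fderiv ℝ f z - B (z - a))
    (φ := fderiv ℝ f a) (s := segment ℝ a y) (C := ε * ‖y - a‖) ?_ ?_ (convex_segment a y)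
    (left_mem_segment ℝ a y) (right_mem_segment ℝ a y)
  · simp only [Real.norm_eq_abs, sub_self, map_zero, mul_zero, sub_zero] at key
    calc _ = |f y - 1 / 2 * B (y - a) (y - a) - f a - (fderiv ℝ f a) (y - a)| := by
            congr 1; ring
      _ ≤ _ := key
      _ = _ := by ring
  · intro z hz
    have hd : HasFDerivAt f (fderiv ℝ f z) z :=
      (h2 z (ball_subset_ball hρ₂ (hseg hz))).hasFDerivAt
    have hs : HasFDerivAt (fun z : E => z - a) (ContinuousLinearMap.id ℝ E) z :=
      (hasFDerivAt_id z).sub_const a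
    have hq := (B.isBoundedBilinearMap.hasFDerivAt (z - a, z - a)).comp z (hs.prodMk hs)
    have := (hd.sub (hq.const_mul (1 / 2 : ℝ))).hasFDerivWithinAt (s := segment ℝ a y)
    refine this.congr_fderiv ?_
    ext v
    simp [IsBoundedBilinearMap.deriv, hsymm v (z - a)]
    ring
  · intro z hz
    have := h1 (z, a) (by
      rw [← ball_prod_same]
      exact ⟨ball_subset_ball hρ₁ (hseg hz), ball_subset_ball hρ₁ ha⟩)
    simp only at this
    rw [sub_right_comm]
    refine this.trans (mul_le_mul_of_nonneg_left ?_ hε.le)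
    have := segment_subset_closedBall_left a y hz
    rwa [mem_closedBall, dist_eq_norm, dist_comm, dist_eq_norm] at this

/-- Finsler's lemma: a quadratic form which is negative definite on a hyperplane becomes negative
definite after subtraction of a multiple of the square of an equation of the hyperplane. -/
theorem exists_negDef_sub_sq [FiniteDimensional ℝ E] (B : E →L[ℝ] E →L[ℝ] ℝ) (l : E →L[ℝ] ℝ)
    (h : ∀ v, l v = 0 → v ≠ 0 → B v v < 0) :
    ∃ M c : ℝ, 0 < c ∧ ∀ v, B v v - M * l v ^ 2 ≤ -c * ‖v‖ ^ 2 := by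
  have hBc : Continuous fun v : E => B v v :=
    B.isBoundedBilinearMap.continuous.comp (continuous_id.prodMk continuous_id)
  obtain ⟨M, hM⟩ : ∃ M : ℝ, ∀ v ∈ sphere (0 : E) 1, B v v - M * l v ^ 2 < 0 := by
    -- Only these unit vectors need correcting. They form a compact set on which `l` has no zero, so
    -- `l ^ 2` is bounded below there.
    set K : Set E := sphere (0 : E) 1 ∩ {v | 0 ≤ B v v}
    have hK : IsCompact K := (isCompact_sphere 0 1).inter_right (isClosed_le continuous_const hBc)
    rcases K.eq_empty_or_nonempty with hKe | hKn
    · refine ⟨0, fun v hv => ?_⟩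
      by_contra hcon
      have : v ∈ K := ⟨hv, by simp at hcon; exact hcon⟩
      simp [hKe] at this
    · obtain ⟨v₀, hv₀, hmin⟩ := hK.exists_isMinOn hKn
        (f := fun v => l v ^ 2) (by fun_prop)
      obtain ⟨v₁, hv₁, hmax⟩ := hK.exists_isMaxOn hKn hBc.continuousOn
      have hδ : 0 < l v₀ ^ 2 := by
        have : l v₀ ≠ 0 := fun h0 => by
          have := h v₀ h0 (by rintro rfl; simpa using hv₀.1)
          have h' := hv₀.2
          simp only [Set.mem_ofPred_eq] at h'
          linarith
        positivity
      have hb : 0 ≤ B v₁ v₁ := hv₁.2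
      refine ⟨(B v₁ v₁ + 1) / l v₀ ^ 2, fun v hv => ?_⟩
      have hMp : 0 ≤ (B v₁ v₁ + 1) / l v₀ ^ 2 := by positivity
      by_cases hvK : 0 ≤ B v v
      · have e1 : B v v ≤ B v₁ v₁ := hmax (a := v) ⟨hv, hvK⟩
        have e2 : l v₀ ^ 2 ≤ l v ^ 2 := hmin (a := v) ⟨hv, hvK⟩
        have e3 := mul_le_mul_of_nonneg_left e2 hMp
        rw [div_mul_cancel₀ _ hδ.ne'] at e3
        linarith
      · have : 0 ≤ (B v₁ v₁ + 1) / l v₀ ^ 2 * l v ^ 2 := by positivity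
        linarith
  obtain ⟨c, hc, hcS⟩ : ∃ c : ℝ, 0 < c ∧ ∀ v ∈ sphere (0 : E) 1, B v v - M * l v ^ 2 ≤ -c := by
    rcases (sphere (0 : E) 1).eq_empty_or_nonempty with hS | hS
    · exact ⟨1, one_pos, by simp [hS]⟩
    · obtain ⟨v₀, hv₀, hmax⟩ := (isCompact_sphere (0 : E) 1).exists_isMaxOn hS
        (f := fun v => B v v - M * l v ^ 2) (by fun_prop)
      refine ⟨-(B v₀ v₀ - M * l v₀ ^ 2), by linarith [hM v₀ hv₀], fun v hv => ?_⟩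
      have := hmax hv
      simp only [Set.mem_ofPred_eq] at this
      linarith
  refine ⟨M, c, hc, fun v => ?_⟩
  rcases eq_or_ne v 0 with rfl | hv
  · simp
  · have hn : 0 < ‖v‖ := norm_pos_iff.2 hv
    have := hcS (‖v‖⁻¹ • v) (by simp [norm_smul, hn.ne'])
    simp only [map_smul, smul_apply, smul_eq_mul] at this
    have e : ‖v‖ ^ 2 * (‖v‖⁻¹ * (‖v‖⁻¹ * (B v) v) - M * (‖v‖⁻¹ * l v) ^ 2)
        = B v v - M * l v ^ 2 := by
      field_simp
    rw [← e]
    nlinarith [sq_nonneg ‖v‖]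

/-- A negative semidefinite form vanishes on a vector as soon as its quadratic form does. -/
theorem apply_eq_zero_of_apply_self_eq_zero (B : E →L[ℝ] E →L[ℝ] ℝ) (hsymm : ∀ v w, B v w = B w v)
    (T : Submodule ℝ E) (hB : ∀ v ∈ T, B v v ≤ 0) {v w : E} (hv : v ∈ T) (hw : w ∈ T)
    (h0 : B v v = 0) : B v w = 0 := by
  by_contra hne
  have key : ∀ t : ℝ, 2 * t * B v w + t ^ 2 * B w w ≤ 0 := fun t => by
    have := hB (v + t • w) (T.add_mem hv (T.smul_mem t hw))
    simp only [map_add, map_smul, add_apply, smul_apply,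
      smul_eq_mul, h0, hsymm w v] at this
    linarith
  have hww := hB w hw
  set s := B v w
  have hs : 0 < s ^ 2 := by positivity
  -- This `t` has the sign of `s` and is small enough for the linear term to beat the quadratic one,
  -- even when `B w w = 0`.
  have h1 := key (s / (1 - B w w))
  have hd : 0 < 1 - B w w := by linarith
  have : 2 * (s / (1 - B w w)) * s + (s / (1 - B w w)) ^ 2 * B w w
      = s ^ 2 * (2 - B w w) / (1 - B w w) ^ 2 := by
    field_simp
    ring
  rw [this] at h1
  have : 0 < s ^ 2 * (2 - B w w) / (1 - B w w) ^ 2 := by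
    apply div_pos (mul_pos hs (by linarith)) (by positivity)
  linarith

/-- The superlevel set of a function lying below its tangents is convex. -/
theorem convex_superlevel {F : E → ℝ} {D : E → E →L[ℝ] ℝ} {s : Set E} (hs : Convex ℝ s)
    (h : ∀ a ∈ s, ∀ y ∈ s, F y ≤ F a + D a (y - a)) : Convex ℝ {y ∈ s | 0 < F y} := by
  rintro x ⟨hx, hFx⟩ y ⟨hy, hFy⟩ a b ha hb hab
  set z := a • x + b • y with hz
  have hzs : z ∈ s := hs hx hy ha hb hab
  refine ⟨hzs, ?_⟩
  have e1 := h z hzs x hx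
  have e2 := h z hzs y hy
  have e3 : a * D z (x - z) + b * D z (y - z) = 0 := by
    rw [← smul_eq_mul, ← smul_eq_mul, ← map_smul, ← map_smul, ← map_add]
    have : a • (x - z) + b • (y - z) = 0 := by
      rw [smul_sub, smul_sub, sub_add_sub_comm, ← hz, ← add_smul, hab, one_smul, sub_self]
    rw [this, map_zero]
  have e4 : F z = a * F z + b * F z := by rw [← add_mul, hab, one_mul]
  have e5 : 0 < a * F x + b * F y := by
    rcases ha.eq_or_lt with rfl | ha'
    · have : b = 1 := by linarith
      subst this; simpa using hFy
    · have := mul_pos ha' hFx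
      have := mul_nonneg hb hFy.le
      linarith
  nlinarith [mul_le_mul_of_nonneg_left e1 ha, mul_le_mul_of_nonneg_left e2 hb]

end Calculus

theorem eventually_mul_lt_of_pos (A : ℝ) {B : ℝ} (hB : 0 < B) : ∀ᶠ t in 𝓝[>] (0 : ℝ), t * A < B := by
  have : Tendsto (fun t : ℝ => t * A) (𝓝[>] 0) (𝓝 (0 * A)) :=
    ((continuous_id.mul continuous_const).tendsto 0).mono_left nhdsWithin_le_nhds
  exact this.eventually_lt_const (by simpa using hB)

/-! ### Local equations of the boundary: support, Hessian, curvature -/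

section LocalEquation

variable {E : Type*} [NormedAddCommGroup E] [InnerProductSpace ℝ E] [FiniteDimensional ℝ E]

theorem IsLocalEquation.eq_zero {S : Set E} {p : E} {U : Set E} {f : E → ℝ}
    (h : IsLocalEquation S p U f) (hp : p ∈ S) : f p = 0 := by
  have : p ∈ S ∩ U := ⟨hp, h.mem⟩
  rw [h.inter_eq] at this
  exact this.2

theorem IsLocalEquation.mem_of_eq_zero {S : Set E} {p : E} {U : Set E} {f : E → ℝ}
    (h : IsLocalEquation S p U f) {y : E} (hy : y ∈ U) (h0 : f y = 0) : y ∈ S := by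
  have : y ∈ S ∩ U := by rw [h.inter_eq]; exact ⟨hy, h0⟩
  exact this.1

theorem IsLocalEquation.contDiffAt {S : Set E} {p : E} {U : Set E} {f : E → ℝ}
    (h : IsLocalEquation S p U f) {y : E} (hy : y ∈ U) : ContDiffAt ℝ 2 f y :=
  h.contDiffOn.contDiffAt (h.isOpen.mem_nhds hy)

omit [FiniteDimensional ℝ E] in
theorem IsConvexDomain.exists_support {C : Set E} (hC : IsConvexDomain C) {p : E}
    (hp : p ∈ frontier C) :
    ∃ l : E →L[ℝ] ℝ, (∀ y ∈ C, l p < l y) ∧ ∀ y ∈ closure C, l p ≤ l y := by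
  have hpC : p ∉ C := fun h => by
    rw [hC.isOpen.frontier_eq] at hp
    exact hp.2 h
  obtain ⟨l, hl⟩ := geometric_hahn_banach_point_open hC.convex hC.isOpen hpC
  exact ⟨l, hl, fun y hy => closure_minimal (fun z hz => (hl z hz).le)
    (isClosed_le continuous_const l.continuous) hy⟩

/-- A supporting functional is a multiple of the differential of a local equation. -/
theorem IsLocalEquation.exists_eq_smul_fderiv {S : Set E} {p : E} {U : Set E} {f : E → ℝ}
    (h : IsLocalEquation S p U f) (hp : p ∈ S) {l : E →L[ℝ] ℝ} (hl0 : l ≠ 0)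
    (hl : ∀ y ∈ S, l p ≤ l y) : ∃ r : ℝ, r ≠ 0 ∧ l = r • fderiv ℝ f p := by
  have hf0 := h.eq_zero hp
  have hext : IsLocalExtrOn l {x | f x = f p} p := by
    left
    have : U ∈ 𝓝[{x | f x = f p}] p := mem_nhdsWithin_of_mem_nhds (h.isOpen.mem_nhds h.mem)
    filter_upwards [this, self_mem_nhdsWithin] with y hyU hy
    exact hl y (h.mem_of_eq_zero hyU (hy.trans hf0))
  obtain ⟨a, b, hab, heq⟩ := hext.exists_multipliers_of_hasStrictFDerivAt_1d
    ((h.contDiffAt h.mem).hasStrictFDerivAt (by norm_num)) l.hasStrictFDerivAt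
  -- The multiplier of `l` cannot vanish because the differential of `f` at `p` does not.
  have hb : b ≠ 0 := by
    rintro rfl
    have ha : a ≠ 0 := fun h0 => hab (by simp [h0])
    have : fderiv ℝ f p = 0 := by simpa [ha] using heq
    exact h.gradient_ne_zero p h.mem (by simp [gradient, this])
  have key : l = (-(b⁻¹ * a)) • fderiv ℝ f p := by
    have : b • l = -(a • fderiv ℝ f p) := by
      rw [eq_neg_iff_add_eq_zero, add_comm]; exact heq
    rw [neg_smul, mul_smul, ← smul_neg, ← this, smul_smul, inv_mul_cancel₀ hb, one_smul]
  refine ⟨_, fun h0 => hl0 ?_, key⟩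
  rw [key, h0, zero_smul]

/-- The second order necessary condition at a point of support. -/
theorem IsLocalEquation.hessian_nonpos {S : Set E} {p : E} {U : Set E} {f : E → ℝ}
    (h : IsLocalEquation S p U f) (hp : p ∈ S) {l : E →L[ℝ] ℝ} {g : E} (hg : 0 < l g)
    (hl : ∀ y ∈ S, l p ≤ l y) {r : ℝ} (hr : l = r • fderiv ℝ f p) {v : E}
    (hv : fderiv ℝ f p v = 0) : r * fderiv ℝ (fderiv ℝ f) p v v ≤ 0 := by
  -- Otherwise `r * f` is positive at `p + t • v`, on the supporting hyperplane, and negative a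
  -- little below it. It vanishes in between, at a point of `S` strictly below the hyperplane.
  by_contra! hpos
  have hf0 := h.eq_zero hp
  set B := fderiv ℝ (fderiv ℝ f) p
  have hl' : ∀ w, l w = r * fderiv ℝ f p w := fun w => by rw [hr]; rfl
  -- With this `ε` the Taylor error along `t • v` is at most half of the quadratic term.
  have hε : 0 < r * B v v / (4 * (|r| * ‖v‖ ^ 2 + 1)) := by positivity
  obtain ⟨ρ, hT, hρU, hρ⟩ := ((exists_taylor_bound (h.contDiffAt h.mem) hε).and
    ((((Metric.nhds_basis_ball (x := p)).mem_iff.1 (h.isOpen.mem_nhds h.mem)).elim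
      fun ρ hρ => (eventually_mul_lt_of_pos 1 hρ.1).mono fun t ht =>
        (ball_subset_ball (by linarith : t ≤ ρ)).trans hρ.2).and self_mem_nhdsWithin)).exists
  replace hρ : 0 < ρ := hρ
  have hfc : ContinuousOn f U := h.contDiffOn.continuousOn
  -- a point below `p`
  obtain ⟨s, hs0, hsρ, hsneg⟩ : ∃ s : ℝ, 0 < s ∧ s * ‖g‖ < ρ / 2 ∧ r * f (p - s • g) < 0 := by
    have hd : HasDerivAt (fun s : ℝ => r * f (p - s • g)) (-l g) 0 := by
      have h1 : HasDerivAt (fun s : ℝ => p - s • g) (-g) 0 := by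
        simpa using ((hasDerivAt_id (0 : ℝ)).smul_const g).const_sub p
      have h2 : HasFDerivAt f (fderiv ℝ f p) (p - (0 : ℝ) • g) := by
        simpa using ((h.contDiffAt h.mem).differentiableAt (by norm_num)).hasFDerivAt
      have := (h2.comp_hasDerivAt (0 : ℝ) h1).const_mul r
      rwa [map_neg, mul_neg, ← hl'] at this
    have h1 := (hd.tendsto_slope.mono_left (nhdsGT_le_nhdsNE 0)).eventually_lt_const
      (show -l g < 0 by linarith)
    obtain ⟨s, ⟨hs1, hs2⟩, hs3⟩ := ((h1.and (eventually_mul_lt_of_pos ‖g‖ (half_pos hρ))).and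
      self_mem_nhdsWithin).exists
    replace hs3 : 0 < s := hs3
    refine ⟨s, hs3, hs2, ?_⟩
    simp only [slope_def_field, zero_smul, sub_zero, hf0, mul_zero] at hs1
    exact ((div_neg_iff.1 hs1).resolve_left fun h => by linarith [h.2]).1
  have hc : ContinuousAt (fun t : ℝ => r * f (p + t • v - s • g)) 0 := by
    refine continuousAt_const.mul (ContinuousAt.comp' (f := fun t : ℝ => p + t • v - s • g) ?_
      (by fun_prop))
    simp only [zero_smul, add_zero]
    refine hfc.continuousAt (h.isOpen.mem_nhds (hρU ?_))
    rw [mem_ball_iff_norm, sub_sub_cancel_left, norm_neg, norm_smul, Real.norm_of_nonneg hs0.le]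
    linarith
  obtain ⟨t, ⟨ht1, ht2⟩, ht0⟩ := (((hc.tendsto.mono_left
    (nhdsWithin_le_nhds (s := Set.Ioi 0))).eventually_lt_const (by simpa using hsneg)).and
    (eventually_mul_lt_of_pos ‖v‖ (half_pos hρ)) |>.and self_mem_nhdsWithin).exists
  replace ht0 : 0 < t := ht0
  have hball : ∀ s' ∈ Set.Icc 0 s, p + t • v - s' • g ∈ ball p ρ := fun s' hs' => by
    rw [mem_ball_iff_norm, add_sub_assoc, add_sub_cancel_left]
    calc _ ≤ ‖t • v‖ + ‖s' • g‖ := norm_sub_le _ _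
      _ = t * ‖v‖ + s' * ‖g‖ := by
        rw [norm_smul, norm_smul, Real.norm_of_nonneg ht0.le, Real.norm_of_nonneg hs'.1]
      _ ≤ t * ‖v‖ + s * ‖g‖ := by gcongr; exact hs'.2
      _ < ρ := by linarith
  have hpos' : 0 < r * f (p + t • v) := by
    have := hT p (mem_ball_self hρ) (p + t • v) (by simpa using hball 0 ⟨le_rfl, hs0.le⟩)
    simp only [add_sub_cancel_left, map_smul, hv, hf0, smul_apply, smul_eq_mul, mul_zero, sub_zero,
      norm_smul, Real.norm_of_nonneg ht0.le] at this
    have h2 := mul_le_mul_of_nonneg_left this (abs_nonneg r)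
    rw [← abs_mul] at h2
    have h3 := (abs_le.1 h2).1
    have h4 : r * B v v / (4 * (|r| * ‖v‖ ^ 2 + 1)) * (|r| * ‖v‖ ^ 2) ≤ r * B v v / 4 := by
      rw [div_mul_eq_mul_div, div_le_div_iff₀ (by positivity) (by positivity)]
      nlinarith
    have h5 := mul_le_mul_of_nonneg_left h4 (sq_nonneg t)
    have h6 : 0 < t ^ 2 * (r * B v v) := by positivity
    nlinarith
  obtain ⟨s', hs', hz⟩ : ∃ s' ∈ Set.Icc 0 s, r * f (p + t • v - s' • g) = 0 := by
    have hcont : ContinuousOn (fun s' : ℝ => r * f (p + t • v - s' • g)) (Set.Icc 0 s) :=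
      continuousOn_const.mul (hfc.comp (by fun_prop) fun s' hs' => hρU (hball s' hs'))
    exact intermediate_value_Icc' hs0.le hcont ⟨ht1.le, by simpa using hpos'.le⟩
  have hr0 : r ≠ 0 := by rintro rfl; simp at hpos
  have hs'0 : 0 < s' := by
    rcases hs'.1.eq_or_lt with h0 | h0
    · rw [← h0, zero_smul, sub_zero] at hz; linarith
    · exact h0
  have := hl _ (h.mem_of_eq_zero (hρU (hball s' hs')) ((mul_eq_zero.1 hz).resolve_left hr0))
  rw [map_sub, map_add, map_smul, map_smul, hl' v, hv] at this
  simp only [mul_zero, smul_eq_mul, add_zero] at this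
  nlinarith [mul_pos hs'0 hg]

/-- The Gauss–Kronecker curvature vanishes if the Hessian is degenerate on the tangent space. -/
theorem gaussCurvature_eq_zero {f : E → ℝ} {p : E} (hf : ContDiffAt ℝ 2 f p)
    (hgrad : gradient f p ≠ 0) {v : E} (hv0 : v ≠ 0) (hv : fderiv ℝ f p v = 0)
    (hB : ∀ w, fderiv ℝ f p w = 0 → fderiv ℝ (fderiv ℝ f) p v w = 0) :
    gaussCurvature f p = 0 := by
  set B := fderiv ℝ (fderiv ℝ f) p
  have hDf : HasFDerivAt (fderiv ℝ f) B p :=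
    ((hf.fderiv_right (m := 1) (by norm_num)).differentiableAt (by norm_num)).hasFDerivAt
  have hlin : IsBoundedLinearMap ℝ fun φ : E →L[ℝ] ℝ => (InnerProductSpace.toDual ℝ E).symm φ :=
    IsLinearMap.with_bound ⟨fun x y => map_add _ x y, fun c x => by simp⟩ 1 fun x => by simp
  have hG : HasFDerivAt (gradient f) (hlin.toContinuousLinearMap.comp B) p :=
    hlin.hasFDerivAt.comp p hDf
  have hk : DifferentiableAt ℝ (fun x => ‖gradient f x‖⁻¹) p :=
    (hG.differentiableAt.norm ℝ hgrad).inv (norm_ne_zero_iff.2 hgrad)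
  have hN : HasFDerivAt (unitNormal f) _ p := hk.hasFDerivAt.smul hG
  set v' : tangentSpace f p := ⟨v, hv⟩
  -- Differentiating the norm factor yields a multiple of the gradient, which is normal to the
  -- tangent space. The other term pairs with a tangent `w` as a multiple of `B v w = 0`.
  have hker : shapeOperator f p v' = 0 := by
    simp only [shapeOperator, LinearMap.comp_apply, Submodule.subtype_apply]
    change (tangentSpace f p).orthogonalProjectionOnto (-(fderiv ℝ (unitNormal f) p v)) = 0
    rw [Submodule.orthogonalProjectionOnto_eq_zero_iff, Submodule.neg_mem_iff,
      Submodule.mem_orthogonal']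
    intro w hw
    have hw' : fderiv ℝ f p w = 0 := hw
    rw [hN.fderiv]
    have e : inner ℝ ((hlin.toContinuousLinearMap : (E →L[ℝ] ℝ) →L[ℝ] E) (B v)) w = B v w :=
      InnerProductSpace.toDual_symm_apply
    simp [inner_add_left, inner_smul_left, hw']
    exact Or.inr (e.trans (hB w hw'))
  unfold gaussCurvature
  by_contra hdet
  have : v' = 0 := (LinearMap.equivOfDetNeZero _ hdet).injective (by
    rw [map_zero]; exact hker)
  exact hv0 (congrArg Subtype.val this)

end LocalEquation

/-! ### Uniform pinching of the domain at its boundary points -/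

section Osculation

variable {E : Type*} [NormedAddCommGroup E] [InnerProductSpace ℝ E] [FiniteDimensional ℝ E]

/-- Near a point of its boundary, a strictly convex domain is a superlevel set of a function which
is pinched between quadratic functions at all nearby points. -/
theorem IsStrictlyConvexDomain.exists_local_equation {C : Set E} (hC : IsStrictlyConvexDomain C)
    {p : E} (hp : p ∈ frontier C) :
    ∃ (F : E → ℝ) (l : E →L[ℝ] ℝ) (c L : ℝ), 0 < c ∧ 0 < L ∧ fderiv ℝ F p = l ∧ F p = 0 ∧
      (∀ y ∈ C, 0 < l (y - p)) ∧
      ∀ᶠ ρ in 𝓝[>] (0 : ℝ), (∀ a ∈ ball p ρ, ‖fderiv ℝ F a‖ ≤ L ∧ (F a = 0 ↔ a ∈ frontier C)) ∧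
        ContinuousOn F (ball p ρ) ∧
        ∀ a ∈ ball p ρ, ∀ y ∈ ball p ρ,
          F y ≤ F a + fderiv ℝ F a (y - a) - c * ‖y - a‖ ^ 2 ∧
          F a + fderiv ℝ F a (y - a) - L * ‖y - a‖ ^ 2 ≤ F y := by
  obtain ⟨U, f, hf⟩ := hC.isC2Hypersurface p hp
  obtain ⟨l, hl, hl'⟩ := hC.exists_support hp
  obtain ⟨y₀, hy₀⟩ := hC.nonempty
  have hl0 : l ≠ 0 := fun h => by simpa [h] using hl y₀ hy₀
  have hfr : ∀ y ∈ frontier C, l p ≤ l y := fun y hy => hl' y (frontier_subset_closure hy)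
  obtain ⟨r, hr0, hr⟩ := hf.exists_eq_smul_fderiv hp hl0 hfr
  have hf2 : ContDiffAt ℝ 2 f p := hf.contDiffAt hf.mem
  have hf0 : f p = 0 := hf.eq_zero hp
  set B := fderiv ℝ (fderiv ℝ f) p with hBdef
  have hsymm : ∀ v w, B v w = B w v := fun v w => (hf2.isSymmSndFDerivAt (by simp)) v w
  have hnonpos : ∀ v, fderiv ℝ f p v = 0 → r * B v v ≤ 0 := fun v hv =>
    hf.hessian_nonpos hp (g := y₀ - p) (by rw [map_sub]; linarith [hl y₀ hy₀]) hfr hr hv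
  have hneg : ∀ v, fderiv ℝ f p v = 0 → v ≠ 0 → (r • B) v v < 0 := fun v hv hv0 => by
    refine lt_of_le_of_ne (hnonpos v hv) fun h0 => ?_
    refine hC.gaussCurvature_ne_zero p hp U f hf
      (gaussCurvature_eq_zero hf2 (hf.gradient_ne_zero p hf.mem) hv0 hv fun w hw => ?_)
    have := apply_eq_zero_of_apply_self_eq_zero (r • B) (fun v w => by simp [hsymm v w])
      (LinearMap.ker (fderiv ℝ f p : E →ₗ[ℝ] ℝ)) (fun v hv => hnonpos v hv) (v := v) (w := w)
      hv hw h0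
    exact (mul_eq_zero.1 this).resolve_left hr0
  obtain ⟨M, c, hc, hMc⟩ := exists_negDef_sub_sq (r • B) (fderiv ℝ f p) hneg
  -- Since `f p = 0`, the square leaves the differential at `p` equal to `l` but subtracts `M` times
  -- the square of `fderiv ℝ f p` from the Hessian. The factor `r - M / 2 * f` is nonzero near `p`,
  -- so the zero set is locally unchanged.
  set F : E → ℝ := fun x => r * f x - M / 2 * f x ^ 2 with hF
  have hF2 : ContDiffAt ℝ 2 F p :=
    (contDiffAt_const.mul hf2).sub (contDiffAt_const.mul (hf2.pow 2))
  have hdF : ∀ x ∈ U, fderiv ℝ F x = (r - M * f x) • fderiv ℝ f x := fun x hx => by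
    have hd := ((hf.contDiffAt hx).differentiableAt (by norm_num)).hasFDerivAt
    have hFx : HasFDerivAt F _ x := (hd.const_mul r).sub ((hd.pow 2).const_mul (M / 2))
    rw [hFx.fderiv]
    ext v
    simp
    ring
  have hFp : fderiv ℝ F p = l := by rw [hdF p hf.mem, hf0, mul_zero, sub_zero, ← hr]
  have hd2 : ∀ v, fderiv ℝ (fderiv ℝ F) p v v = (r • B) v v - M * fderiv ℝ f p v ^ 2 := fun v => by
    have e : fderiv ℝ F =ᶠ[𝓝 p] fun x => (r - M * f x) • fderiv ℝ f x := by
      filter_upwards [hf.isOpen.mem_nhds hf.mem] with x hx using hdF x hx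
    have hd := (hf2.differentiableAt (by norm_num)).hasFDerivAt
    have hdd : HasFDerivAt (fderiv ℝ f) B p :=
      ((hf2.fderiv_right (m := 1) (by norm_num)).differentiableAt (by norm_num)).hasFDerivAt
    have hdF' : HasFDerivAt (fun x => (r - M * f x) • fderiv ℝ f x) _ p :=
      ((hd.const_mul M).const_sub r).smul hdd
    rw [e.fderiv_eq, hdF'.fderiv]
    simp [hf0]
    ring
  set L : ℝ := ‖l‖ + 1 + ‖fderiv ℝ (fderiv ℝ F) p‖ + c with hL
  -- Half the Hessian contributes `-c / 2`, and the Taylor error takes back `c / 4`.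
  refine ⟨F, l, c / 4, L, by positivity, by positivity, hFp, by simp [hF, hf0],
    fun y hy => by rw [map_sub]; linarith [hl y hy], ?_⟩
  have hcD : ContinuousAt (fderiv ℝ F) p :=
    (hF2.fderiv_right (m := 1) (by norm_num)).continuousAt
  have h1 : ∀ᶠ a in 𝓝 p, ‖fderiv ℝ F a‖ < ‖l‖ + 1 :=
    hcD.norm.eventually_lt_const (by simp only [hFp]; linarith)
  have h2 : ∀ᶠ a in 𝓝 p, r - M / 2 * f a ≠ 0 := by
    have : ContinuousAt (fun a => r - M / 2 * f a) p :=
      continuousAt_const.sub (continuousAt_const.mul hf2.continuousAt)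
    exact this.eventually_ne (by simpa [hf0] using hr0)
  obtain ⟨ρ₁, hρ₁, h3⟩ := Metric.eventually_nhds_iff_ball.1
    ((h1.and h2).and (hf.isOpen.mem_nhds hf.mem))
  filter_upwards [exists_taylor_bound hF2 (show 0 < c / 4 by positivity),
    Ioo_mem_nhdsGT hρ₁] with ρ hT hρ
  have hsub := ball_subset_ball (x := p) hρ.2.le
  refine ⟨fun a ha => ⟨?_, ?_⟩, ?_, fun a ha y hy => ⟨?_, ?_⟩⟩
  · have := (h3 a (hsub ha)).1.1
    have : 0 ≤ ‖fderiv ℝ (fderiv ℝ F) p‖ := by positivity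
    linarith
  · have e : F a = f a * (r - M / 2 * f a) := by simp only [hF]; ring
    rw [e, mul_eq_zero, or_iff_left (h3 a (hsub ha)).1.2]
    refine ⟨hf.mem_of_eq_zero (h3 a (hsub ha)).2, fun h => ?_⟩
    have : a ∈ frontier C ∩ U := ⟨h, (h3 a (hsub ha)).2⟩
    rw [hf.inter_eq] at this
    exact this.2
  · have hfc : ContinuousOn f (ball p ρ) :=
      hf.contDiffOn.continuousOn.mono fun a ha => (h3 a (hsub ha)).2
    exact (continuousOn_const.mul hfc).sub (continuousOn_const.mul (hfc.pow 2))
  · have := (abs_le.1 (hT a ha y hy)).2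
    have := hMc (y - a)
    rw [← hd2] at this
    linarith
  · have h5 := (abs_le.1 (hT a ha y hy)).1
    have h6 := (fderiv ℝ (fderiv ℝ F) p).le_opNorm₂ (y - a) (y - a)
    have h7 := (abs_le.1 h6).1
    have h8 : 0 ≤ ‖fderiv ℝ (fderiv ℝ F) p‖ * ‖y - a‖ ^ 2 := by positivity
    have h9 : 0 ≤ (‖l‖ + 1) * ‖y - a‖ ^ 2 := by positivity
    have h10 : 0 ≤ c * ‖y - a‖ ^ 2 := by positivity
    rw [hL]
    nlinarith

/-- Local comparison of a strictly convex domain with balls tangent to its boundary. -/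
theorem IsStrictlyConvexDomain.exists_local_osculation {C : Set E}
    (hC : IsStrictlyConvexDomain C) {p : E} (hp : p ∈ frontier C) :
    ∃ (ρ c L : ℝ) (N : E → E →L[ℝ] ℝ), 0 < ρ ∧ 0 < c ∧ 0 < L ∧
      ∀ a ∈ frontier C ∩ ball p ρ, ‖N a‖ ≤ L ∧
        (∀ y ∈ closure C ∩ ball p ρ, c * ‖y - a‖ ^ 2 ≤ N a (y - a)) ∧
        ∀ y ∈ ball p ρ, L * ‖y - a‖ ^ 2 < N a (y - a) → y ∈ C := by
  obtain ⟨F, l, c, L, hc, hL, hFl, hFp, hl, hev⟩ := hC.exists_local_equation hp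
  obtain ⟨ρ, ⟨h1, hcont, h2⟩, hρ⟩ := (hev.and self_mem_nhdsWithin).exists
  replace hρ : 0 < ρ := hρ
  have hpb : p ∈ ball p ρ := mem_ball_self hρ
  -- the superlevel set meets the domain
  obtain ⟨w, hwC, hwb, hwF⟩ : ∃ w ∈ C, w ∈ ball p ρ ∧ 0 < F w := by
    obtain ⟨y₀, hy₀⟩ := hC.nonempty
    obtain ⟨t, ⟨⟨ht1, ht2⟩, ht3⟩, ht0⟩ := (((eventually_mul_lt_of_pos 1 one_pos).and
      (eventually_mul_lt_of_pos ‖y₀ - p‖ hρ)).and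
      (eventually_mul_lt_of_pos (L * ‖y₀ - p‖ ^ 2) (hl y₀ hy₀)) |>.and self_mem_nhdsWithin).exists
    replace ht0 : 0 < t := ht0
    have hb : p + t • (y₀ - p) ∈ ball p ρ := by
      rwa [mem_ball_iff_norm, add_sub_cancel_left, norm_smul, Real.norm_of_nonneg ht0.le]
    refine ⟨p + t • (y₀ - p), ?_, hb, ?_⟩
    · have := hC.convex.combo_closure_interior_mem_interior (frontier_subset_closure hp)
        (by rwa [hC.isOpen.interior_eq]) (show 0 ≤ 1 - t by linarith) ht0 (by ring)
      rw [hC.isOpen.interior_eq] at this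
      convert this using 1
      module
    · have := (h2 p hpb _ hb).2
      rw [add_sub_cancel_left, hFp, hFl, map_smul, norm_smul, Real.norm_of_nonneg ht0.le,
        smul_eq_mul] at this
      nlinarith
  -- The superlevel set is convex, hence connected; it avoids the frontier of `C` and meets `C`, so
  -- it lies in `C`.
  have hpos : ∀ y ∈ ball p ρ, 0 < F y → y ∈ C := by
    have hconv : Convex ℝ {y ∈ ball p ρ | 0 < F y} :=
      convex_superlevel (D := fderiv ℝ F) (convex_ball p ρ) fun a ha y hy => by
        have := (h2 a ha y hy).1
        have : 0 ≤ c * ‖y - a‖ ^ 2 := by positivity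
        linarith
    have hsub := hconv.isPreconnected.subset_left_of_subset_union hC.isOpen
      isClosed_closure.isOpen_compl (disjoint_compl_right.mono_left subset_closure)
      (fun y hy => by
        by_contra hcon
        rw [Set.mem_union, not_or, Set.mem_compl_iff, not_not] at hcon
        have : y ∈ frontier C := by rw [hC.isOpen.frontier_eq]; exact ⟨hcon.2, hcon.1⟩
        exact hy.2.ne' ((h1 y hy.1).2.2 this))
        (show ({y ∈ ball p ρ | 0 < F y} ∩ C).Nonempty from ⟨w, ⟨hwb, hwF⟩, hwC⟩)
    exact fun y hy hF => hsub ⟨hy, hF⟩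
  have hC0 : ∀ y ∈ C ∩ ball p ρ, 0 ≤ F y := by
    intro y hy
    by_contra! hneg
    obtain ⟨z, hz, hz0⟩ := (hC.convex.inter (convex_ball p ρ)).isPreconnected.intermediate_value
      hy (show w ∈ C ∩ ball p ρ from ⟨hwC, hwb⟩) (hcont.mono Set.inter_subset_right)
        (show (0 : ℝ) ∈ Set.Icc (F y) (F w) from ⟨hneg.le, hwF.le⟩)
    have := (h1 z hz.2).2.1 hz0
    rw [hC.isOpen.frontier_eq] at this
    exact this.2 hz.1
  refine ⟨ρ, c, L, fderiv ℝ F, hρ, hc, hL, fun a ha => ⟨(h1 a ha.2).1, fun y hy => ?_,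
    fun y hy hlt => ?_⟩⟩
  · have hF : 0 ≤ F y := by
      by_cases hyC : y ∈ C
      · exact hC0 y ⟨hyC, hy.2⟩
      · exact ((h1 y hy.2).2.2 (by rw [hC.isOpen.frontier_eq]; exact ⟨hy.1, hyC⟩)).ge
    have := (h2 a ha.2 y hy.2).1
    rw [(h1 a ha.2).2.2 ha.1] at this
    linarith
  · have := (h2 a ha.2 y hy).2
    rw [(h1 a ha.2).2.2 ha.1] at this
    exact hpos y hy (by linarith)

/-- The functional `N` defines a tangent hyperplane of `C` at `a` such that the domain is pinched
between two paraboloids at `a`. -/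
def IsPinched (C : Set E) (c L : ℝ) (a : E) (N : E →L[ℝ] ℝ) : Prop :=
  (∀ y ∈ closure C, c * ‖y - a‖ ^ 2 ≤ N (y - a)) ∧ ∀ y, L * ‖y - a‖ ^ 2 < N (y - a) → y ∈ C

omit [FiniteDimensional ℝ E] in
theorem IsPinched.mono {C : Set E} {c c' L L' : ℝ} {a : E} {N : E →L[ℝ] ℝ}
    (h : IsPinched C c L a N) (hc : c' ≤ c) (hL : L ≤ L') : IsPinched C c' L' a N :=
  ⟨fun y hy => (mul_le_mul_of_nonneg_right hc (sq_nonneg _)).trans (h.1 y hy), fun y hy =>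
    h.2 y ((mul_le_mul_of_nonneg_right hL (sq_nonneg _)).trans_lt hy)⟩

/-- Uniform comparison of a strictly convex domain with paraboloids at its boundary points. -/
theorem IsStrictlyConvexDomain.exists_isPinched {C : Set E} (hC : IsStrictlyConvexDomain C) :
    ∃ K : ℝ, 1 ≤ K ∧ ∀ a ∈ frontier C, ∃ N, IsPinched C 1 K a N := by
  have hcomp : IsCompact (frontier C) :=
    Metric.isCompact_of_isClosed_isBounded isClosed_frontier
      (hC.isBounded.closure.subset frontier_subset_closure)
  obtain ⟨d, hd⟩ := hC.isBounded.closure.exists_norm_le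
  have hunif : ∃ c L : ℝ, 0 < c ∧ 0 < L ∧ ∀ a ∈ frontier C, ∃ N, IsPinched C c L a N := by
    refine hcomp.induction_on (p := fun s => ∃ c L : ℝ, 0 < c ∧ 0 < L ∧
      ∀ a ∈ s, ∃ N, IsPinched C c L a N) ⟨1, 1, one_pos, one_pos, by simp⟩ ?_ ?_ ?_
    · rintro s t hst ⟨c, L, hc, hL, h⟩
      exact ⟨c, L, hc, hL, fun a ha => h a (hst ha)⟩
    · rintro s t ⟨c, L, hc, hL, h⟩ ⟨c', L', hc', hL', h'⟩
      refine ⟨min c c', max L L', lt_min hc hc', lt_max_of_lt_left hL, fun a ha => ?_⟩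
      rcases ha with ha | ha
      · obtain ⟨N, hN⟩ := h a ha
        exact ⟨N, hN.mono (min_le_left _ _) (le_max_left _ _)⟩
      · obtain ⟨N, hN⟩ := h' a ha
        exact ⟨N, hN.mono (min_le_right _ _) (le_max_right _ _)⟩
    · intro p hp
      obtain ⟨ρ, c, L, N, hρ, hc, hL, h⟩ := hC.exists_local_osculation hp
      refine ⟨frontier C ∩ ball p (ρ / 2),
        inter_mem_nhdsWithin _ (ball_mem_nhds p (half_pos hρ)), ?_⟩
      -- Contracting the closure of `C` towards `a` by `θ` brings it into the small ball. The lower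
      -- estimate survives with `c * θ`.
      obtain ⟨θ, ⟨hθ1, hθ2⟩, hθ0⟩ := ((eventually_mul_lt_of_pos 1 one_pos).and
        (eventually_mul_lt_of_pos (d + d) (half_pos hρ)) |>.and self_mem_nhdsWithin).exists
      replace hθ0 : 0 < θ := hθ0
      refine ⟨c * θ, max L (2 * L / ρ), by positivity, lt_max_of_lt_left hL, fun a ha => ?_⟩
      have hball : ∀ y, ‖y - a‖ < ρ / 2 → y ∈ ball p ρ := fun y hy => by
        have := ha.2
        rw [mem_ball_iff_norm] at this ⊢
        calc ‖y - p‖ = ‖(y - a) + (a - p)‖ := by rw [sub_add_sub_cancel]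
          _ ≤ ‖y - a‖ + ‖a - p‖ := norm_add_le _ _
          _ < ρ := by linarith
      obtain ⟨hN, hN1, hN2⟩ := h a ⟨ha.1, ball_subset_ball (by linarith) ha.2⟩
      have haC : a ∈ closure C := frontier_subset_closure ha.1
      refine ⟨N a, fun y hy => ?_, fun y hy => ?_⟩
      · have hz : a + θ • (y - a) ∈ closure C := by
          have := hC.convex.closure haC hy (show 0 ≤ 1 - θ by linarith) hθ0.le (by ring)
          convert this using 1
          module
        have hnorm : ‖y - a‖ ≤ d + d := (norm_sub_le _ _).trans (add_le_add (hd y hy) (hd a haC))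
        have := hN1 _ ⟨hz, hball _ (by
          rw [add_sub_cancel_left, norm_smul, Real.norm_of_nonneg hθ0.le]
          exact (mul_le_mul_of_nonneg_left hnorm hθ0.le).trans_lt hθ2)⟩
        rw [add_sub_cancel_left, map_smul, norm_smul, Real.norm_of_nonneg hθ0.le,
          smul_eq_mul] at this
        refine le_of_mul_le_mul_left ?_ hθ0
        calc _ = c * (θ * ‖y - a‖) ^ 2 := by ring
          _ ≤ _ := this
      · refine hN2 y (hball y ?_) ((mul_le_mul_of_nonneg_right (le_max_left _ _)
          (sq_nonneg _)).trans_lt hy)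
        -- Linear growth of `N a` against the constant `2 * L / ρ` forces `‖y - a‖ < ρ / 2`, so the
        -- local statement applies to every such `y`.
        have h3 : N a (y - a) ≤ L * ‖y - a‖ := ((le_abs_self _).trans
          ((N a).le_opNorm _)).trans (mul_le_mul_of_nonneg_right hN (norm_nonneg _))
        have h4 := ((mul_le_mul_of_nonneg_right (le_max_right L (2 * L / ρ))
          (sq_nonneg ‖y - a‖)).trans_lt hy).trans_le h3
        by_contra! hge
        have h5 : L * ‖y - a‖ ≤ 2 * L / ρ * ‖y - a‖ ^ 2 := by
          rw [div_mul_eq_mul_div, le_div_iff₀ hρ]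
          have := mul_le_mul_of_nonneg_left hge (show 0 ≤ L * ‖y - a‖ by positivity)
          nlinarith
        linarith
  obtain ⟨c, L, hc, hL, h⟩ := hunif
  refine ⟨max 1 (L / c), le_max_left _ _, fun a ha => ?_⟩
  obtain ⟨N, hN1, hN2⟩ := h a ha
  refine ⟨c⁻¹ • N, fun y hy => ?_, fun y hy => hN2 y ?_⟩
  · have := hN1 y hy
    rw [smul_apply, smul_eq_mul, one_mul, inv_mul_eq_div, le_div_iff₀ hc]
    linarith
  · have := (mul_le_mul_of_nonneg_right (le_max_right 1 (L / c)) (sq_nonneg ‖y - a‖)).trans_lt hy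
    rw [smul_apply, smul_eq_mul, inv_mul_eq_div, div_mul_eq_mul_div,
      div_lt_div_iff_of_pos_right hc] at this
    exact this

end Osculation

/-! ### The cusp kernel and its uniform integral bound -/

section Kernel

/-- An upper bound, up to a constant, for the Hilbert density near an ideal vertex, in barycentric
coordinates. -/
noncomputable def cuspKernel (p q x y : ℝ) : ℝ :=
  √(p * q * (p + q)) * (x * p + y * q) ^ (-3 / 2 : ℝ)

theorem cuspKernel_comm (p q x y : ℝ) : cuspKernel p q x y = cuspKernel q p y x := by
  unfold cuspKernel
  rw [mul_comm p q, add_comm p q, add_comm (x * p)]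

theorem cuspKernel_pos {p q x y : ℝ} (hp : 0 < p) (hq : 0 < q) (hx : 0 < x) (hy : 0 < y) :
    0 < cuspKernel p q x y := by
  unfold cuspKernel
  positivity

theorem lintegral_rpow_affine_le {p c : ℝ} (hp : 0 < p) (hc : 0 < c) :
    ∫⁻ x in Set.Ioc (0 : ℝ) 1, ENNReal.ofReal ((x * p + c) ^ (-3 / 2 : ℝ)) ≤
      ENNReal.ofReal (2 / p * c ^ (-1 / 2 : ℝ)) := by
  have hpos : ∀ x ∈ Set.Icc (0 : ℝ) 1, 0 < x * p + c := fun x hx => by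
    have := mul_nonneg hx.1 hp.le
    linarith
  have hcont : ContinuousOn (fun x : ℝ => (x * p + c) ^ (-3 / 2 : ℝ)) (Set.Icc 0 1) :=
    ContinuousOn.rpow_const (by fun_prop) fun x hx => Or.inl (hpos x hx).ne'
  have hint : IntervalIntegrable (fun x : ℝ => (x * p + c) ^ (-3 / 2 : ℝ)) volume 0 1 :=
    ContinuousOn.intervalIntegrable (by rwa [Set.uIcc_of_le zero_le_one])
  have hval : ∫ x in (0 : ℝ)..1, (x * p + c) ^ (-3 / 2 : ℝ) =
      -(2 / p) * (1 * p + c) ^ (-1 / 2 : ℝ) - -(2 / p) * (0 * p + c) ^ (-1 / 2 : ℝ) := by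
    refine intervalIntegral.integral_eq_sub_of_hasDerivAt
      (f := fun x => -(2 / p) * (x * p + c) ^ (-1 / 2 : ℝ)) (fun x hx => ?_) hint
    rw [Set.uIcc_of_le zero_le_one] at hx
    have h1 : HasDerivAt (fun x : ℝ => x * p + c) p x := by
      simpa using ((hasDerivAt_id x).mul_const p).add_const c
    have h2 := (h1.rpow_const (p := (-1 / 2 : ℝ)) (Or.inl (hpos x hx).ne')).const_mul (-(2 / p))
    refine h2.congr_deriv ?_
    rw [show (-1 / 2 - 1 : ℝ) = -3 / 2 by norm_num]
    field_simp
  rw [← ofReal_integral_eq_lintegral_ofReal hint.1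
    ((ae_restrict_iff' measurableSet_Ioc).2 (ae_of_all _ fun x hx =>
      Real.rpow_nonneg (hpos x ⟨hx.1.le, hx.2⟩).le _)),
    ← intervalIntegral.integral_of_le zero_le_one, hval]
  apply ENNReal.ofReal_le_ofReal
  have : 0 ≤ 2 / p * (1 * p + c) ^ (-1 / 2 : ℝ) := by positivity
  rw [zero_mul, zero_add]
  linarith

theorem lintegral_rpow_neg_half :
    ∫⁻ y in Set.Ioc (0 : ℝ) 1, ENNReal.ofReal (y ^ (-1 / 2 : ℝ)) = ENNReal.ofReal 2 := by
  have hint : IntervalIntegrable (fun x : ℝ => x ^ (-1 / 2 : ℝ)) volume 0 1 :=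
    intervalIntegral.intervalIntegrable_rpow' (by norm_num)
  rw [← ofReal_integral_eq_lintegral_ofReal hint.1
    ((ae_restrict_iff' measurableSet_Ioc).2 (ae_of_all _ fun x hx =>
      Real.rpow_nonneg hx.1.le _)),
    ← intervalIntegral.integral_of_le zero_le_one, integral_rpow (Or.inl (by norm_num))]
  norm_num

/-- Integrating first in the variable with the larger coefficient `p` leaves a multiple of `√((p +
q) / p) * y ^ (-1 / 2)`, which `q ≤ p` bounds independently of both parameters. -/
theorem lintegral_cuspKernel_le_of_le {p q : ℝ} (hq : 0 < q) (hqp : q ≤ p) :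
    ∫⁻ y in Set.Ioc (0 : ℝ) 1, ∫⁻ x in Set.Ioc (0 : ℝ) 1,
      ENNReal.ofReal (cuspKernel p q x y) ≤ ENNReal.ofReal 6 := by
  have hp : 0 < p := hq.trans_le hqp
  have hinner : ∀ y ∈ Set.Ioc (0 : ℝ) 1, ∫⁻ x in Set.Ioc (0 : ℝ) 1,
      ENNReal.ofReal (cuspKernel p q x y) ≤ ENNReal.ofReal 3 * ENNReal.ofReal (y ^ (-1 / 2 : ℝ)) := by
    intro y hy
    have hc : 0 < y * q := mul_pos hy.1 hq
    simp only [cuspKernel, ENNReal.ofReal_mul (Real.sqrt_nonneg _)]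
    rw [lintegral_const_mul' _ _ ENNReal.ofReal_ne_top]
    refine (mul_le_mul_right (lintegral_rpow_affine_le hp hc) _).trans ?_
    rw [← ENNReal.ofReal_mul (Real.sqrt_nonneg _), ← ENNReal.ofReal_mul (by norm_num)]
    apply ENNReal.ofReal_le_ofReal
    rw [Real.mul_rpow hy.1.le hq.le]
    have hs : q ^ (-1 / 2 : ℝ) = (√q)⁻¹ := by
      rw [Real.sqrt_eq_rpow, ← Real.rpow_neg hq.le]; norm_num
    -- From `p + q ≤ 2 * p`, with `√2` rounded up to `3 / 2`.
    have h1 : √(p * q * (p + q)) ≤ 3 / 2 * p * √q := by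
      rw [Real.sqrt_le_left (by positivity), mul_pow, mul_pow, Real.sq_sqrt hq.le]
      nlinarith [mul_pos hp hq, mul_le_mul_of_nonneg_left hqp (mul_pos hp hq).le]
    have hsq : 0 < √q := Real.sqrt_pos.2 hq
    rw [hs]
    calc √(p * q * (p + q)) * (2 / p * (y ^ (-1 / 2 : ℝ) * (√q)⁻¹))
        ≤ 3 / 2 * p * √q * (2 / p * (y ^ (-1 / 2 : ℝ) * (√q)⁻¹)) := by
          have := hy.1
          gcongr
      _ = 3 * y ^ (-1 / 2 : ℝ) := by field_simp
  refine (setLIntegral_mono' measurableSet_Ioc hinner).trans ?_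
  rw [lintegral_const_mul' _ _ ENNReal.ofReal_ne_top, lintegral_rpow_neg_half,
    ← ENNReal.ofReal_mul (by norm_num)]
  norm_num

/-- The cusp kernel extended by zero outside the unit square. -/
noncomputable def cuspFun (p q : ℝ) : ℝ × ℝ → ENNReal :=
  (Set.Ioc (0 : ℝ) 1 ×ˢ Set.Ioc (0 : ℝ) 1).indicator fun z => ENNReal.ofReal (cuspKernel p q z.1 z.2)

theorem measurable_cuspFun (p q : ℝ) : Measurable (cuspFun p q) := by
  refine Measurable.indicator ?_ (measurableSet_Ioc.prod measurableSet_Ioc)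
  unfold cuspKernel
  fun_prop

theorem cuspFun_comm (p q x y : ℝ) : cuspFun p q (x, y) = cuspFun q p (y, x) := by
  unfold cuspFun
  simp only [Set.indicator_apply, Set.mem_prod, cuspKernel_comm p q, and_comm]

theorem lintegral_cuspFun_le {p q : ℝ} (hp : 0 < p) (hq : 0 < q) :
    ∫⁻ z, cuspFun p q z ≤ ENNReal.ofReal 6 := by
  wlog hqp : q ≤ p generalizing p q
  · refine le_of_eq_of_le ?_ (this hq hp (le_of_not_ge hqp))
    rw [Measure.volume_eq_prod, ← (Measure.measurePreserving_swap (μ := (volume : Measure ℝ))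
      (ν := (volume : Measure ℝ))).lintegral_comp (measurable_cuspFun q p)]
    exact lintegral_congr fun z => cuspFun_comm p q z.1 z.2
  refine le_of_eq_of_le ?_ (lintegral_cuspKernel_le_of_le hq hqp)
  rw [cuspFun, lintegral_indicator (measurableSet_Ioc.prod measurableSet_Ioc), Measure.volume_eq_prod,
    ← Measure.prod_restrict, lintegral_prod_symm']
  unfold cuspKernel
  fun_prop

/-- Passing to another vertex permutes the barycentric coordinates, an affine change of variables of
determinant `±1`. -/
theorem lintegral_cuspFun_shear₁ (p q : ℝ) :
    ∫⁻ z : ℝ × ℝ, cuspFun p q (z.2, 1 - z.1 - z.2) = ∫⁻ z, cuspFun p q z := by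
  have hm := measurable_cuspFun p q
  rw [Measure.volume_eq_prod, lintegral_prod_symm' _ (by fun_prop), lintegral_prod _ (by fun_prop)]
  refine lintegral_congr fun y => ?_
  rw [← lintegral_sub_left_eq_self _ (1 - y)]
  exact lintegral_congr fun x => by simp [sub_right_comm]

theorem lintegral_cuspFun_shear₂ (p q : ℝ) :
    ∫⁻ z : ℝ × ℝ, cuspFun p q (1 - z.1 - z.2, z.1) = ∫⁻ z, cuspFun p q z := by
  have hm := measurable_cuspFun p q
  rw [Measure.volume_eq_prod, lintegral_prod_symm' (cuspFun p q) hm, lintegral_prod _ (by fun_prop)]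
  refine lintegral_congr fun y => ?_
  rw [← lintegral_sub_left_eq_self _ (1 - y)]
  exact lintegral_congr fun x => by simp

end Kernel

/-! ### Room around a point near one ideal vertex -/

section Triangle

variable {E : Type*} [NormedAddCommGroup E] [InnerProductSpace ℝ E]

/-- The largest subset of `C - x` which is symmetric with respect to the origin. -/
def symmetricPart (C : Set E) (x : E) : Set E :=
  {v | x + v ∈ C ∧ x - v ∈ C}

omit [InnerProductSpace ℝ E] in
theorem neg_mem_symmetricPart {C : Set E} {x v : E} (hv : v ∈ symmetricPart C x) :
    -v ∈ symmetricPart C x :=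
  ⟨by simpa [sub_eq_add_neg] using hv.2, by simpa using hv.1⟩

theorem convex_symmetricPart {C : Set E} (hC : Convex ℝ C) (x : E) :
    Convex ℝ (symmetricPart C x) := by
  rintro v ⟨hv, hv'⟩ w ⟨hw, hw'⟩ s t hs ht hst
  have hx : x = s • x + t • x := by rw [← add_smul, hst, one_smul]
  refine ⟨?_, ?_⟩
  · convert hC hv hw hs ht hst using 1
    nth_rewrite 1 [hx]; module
  · convert hC hv' hw' hs ht hst using 1
    nth_rewrite 1 [hx]; module

theorem smul_mem_symmetricPart {C : Set E} (hC : Convex ℝ C) {x v : E}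
    (hv : v ∈ symmetricPart C x) {s : ℝ} (hs : |s| ≤ 1) : s • v ∈ symmetricPart C x := by
  obtain ⟨h1, h2⟩ := abs_le.1 hs
  convert convex_symmetricPart hC x hv (neg_mem_symmetricPart hv)
    (show 0 ≤ (1 + s) / 2 by linarith) (show 0 ≤ (1 - s) / 2 by linarith) (by ring) using 1
  module

theorem add_smul_mem_symmetricPart {C : Set E} (hC : Convex ℝ C) {x v w : E}
    (hv : v ∈ symmetricPart C x) (hw : w ∈ symmetricPart C x) {s t : ℝ} (hs : |s| ≤ 1 / 2)
    (ht : |t| ≤ 1 / 2) : s • v + t • w ∈ symmetricPart C x := by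
  have h2 : ∀ r : ℝ, |r| ≤ 1 / 2 → |2 * r| ≤ 1 := fun r hr => by
    rw [abs_mul, abs_two]; linarith
  convert convex_symmetricPart hC x (smul_mem_symmetricPart hC hv (h2 s hs))
    (smul_mem_symmetricPart hC hw (h2 t ht)) (show (0 : ℝ) ≤ 1 / 2 by norm_num)
    (show (0 : ℝ) ≤ 1 / 2 by norm_num) (by norm_num) using 1
  module

omit [InnerProductSpace ℝ E] in
theorem norm_add_sq_le_two_mul (u v : E) : ‖u + v‖ ^ 2 ≤ 2 * (‖u‖ ^ 2 + ‖v‖ ^ 2) := by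
  have h : ‖u + v‖ ^ 2 ≤ (‖u‖ + ‖v‖) ^ 2 := by
    gcongr
    exact norm_add_le u v
  nlinarith [sq_nonneg (‖u‖ - ‖v‖)]

theorem norm_smul_add_smul_sq_le {β γ : ℝ} (hβ : 0 ≤ β) (hγ : 0 ≤ γ) (u v : E) :
    ‖β • u + γ • v‖ ^ 2 ≤ (β + γ) * (β * ‖u‖ ^ 2 + γ * ‖v‖ ^ 2) := by
  have h1 : ‖β • u + γ • v‖ ≤ β * ‖u‖ + γ * ‖v‖ := by
    refine (norm_add_le _ _).trans_eq ?_
    rw [norm_smul, norm_smul, Real.norm_of_nonneg hβ, Real.norm_of_nonneg hγ]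
  have h2 : ‖β • u + γ • v‖ ^ 2 ≤ (β * ‖u‖ + γ * ‖v‖) ^ 2 := by gcongr
  nlinarith [mul_nonneg (mul_nonneg hβ hγ) (sq_nonneg (‖u‖ - ‖v‖))]

/-- A displacement along `w` followed by a suitable displacement along `τ` is small. -/
theorem mul_norm_sq_lt_of_tangential {K h m s : ℝ} (hK : 0 < K) (hh : 0 < h) {w τ : E}
    (hw : ‖w‖ ^ 2 ≤ h) (hτ : ‖τ‖ ^ 2 ≤ 2 * m ^ 2) (hs : s ^ 2 * m ^ 2 = h / (144 * K ^ 2)) :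
    K * ‖(1 / (8 * K)) • w + s • τ‖ ^ 2 < 1 / (8 * K) * h := by
  have h1 := norm_add_sq_le_two_mul ((1 / (8 * K)) • w) (s • τ)
  rw [norm_smul, norm_smul, mul_pow, mul_pow, Real.norm_eq_abs, Real.norm_eq_abs, sq_abs,
    sq_abs] at h1
  have h2 : s ^ 2 * ‖τ‖ ^ 2 ≤ 2 * (h / (144 * K ^ 2)) := by
    rw [← hs]
    linarith [mul_le_mul_of_nonneg_left hτ (sq_nonneg s)]
  have h3 : (1 / (8 * K)) ^ 2 * ‖w‖ ^ 2 ≤ (1 / (8 * K)) ^ 2 * h := by gcongr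
  have h4 : ‖(1 / (8 * K)) • w + s • τ‖ ^ 2 ≤
      2 * ((1 / (8 * K)) ^ 2 * h + 2 * (h / (144 * K ^ 2))) := by linarith
  calc K * ‖(1 / (8 * K)) • w + s • τ‖ ^ 2
      ≤ K * (2 * ((1 / (8 * K)) ^ 2 * h + 2 * (h / (144 * K ^ 2)))) := by gcongr
    _ = 17 / 36 * (1 / (8 * K) * h) := by field_simp; norm_num
    _ < 1 / (8 * K) * h := by
      have : 0 < 1 / (8 * K) * h := by positivity
      linarith

/-- Transport of a displacement by the homothety with centre at the end of a half-line. -/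
theorem add_third_smul_mem {C : Set E} (hC : Convex ℝ C) (hCo : IsOpen C) {a w v : E} {κ σ : ℝ}
    (hκ : 0 < κ) (hκ1 : κ ≤ 1) (hσ : 0 < σ) (hσ1 : σ ≤ 2 / 3) (hnear : a + κ • w + v ∈ C)
    (hfar : a + (1 / σ) • w ∈ closure C) (hw : a + w ∈ C) : a + w + (1 / 3 : ℝ) • v ∈ C := by
  have hd : 0 < 1 - κ * σ := by nlinarith
  obtain ⟨r, hr⟩ : ∃ r, r = (1 - σ) / (1 - κ * σ) := ⟨_, rfl⟩
  have hr3 : 1 / 3 ≤ r := by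
    rw [hr, div_le_div_iff₀ (by norm_num) hd]
    nlinarith [mul_pos hκ hσ]
  have hr0 : 0 < r := by linarith
  have hr1 : r ≤ 1 := by
    rw [hr, div_le_one hd]
    nlinarith
  have hz : a + w + r • v ∈ C := by
    have := hC.combo_interior_closure_mem_interior (by rw [hCo.interior_eq]; exact hnear)
      hfar hr0 (show 0 ≤ 1 - r by linarith) (by ring)
    rw [hCo.interior_eq] at this
    convert this using 1
    have e : r * κ + (1 - r) * (1 / σ) = 1 := by
      have hrd : r * (1 - κ * σ) = 1 - σ := by rw [hr, div_mul_cancel₀ _ hd.ne']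
      field_simp
      linarith
    have : a + w + r • v = a + (r * κ + (1 - r) * (1 / σ)) • w + r • v := by rw [e, one_smul]
    rw [this]
    module
  have := hC hz hw (show 0 ≤ 1 / (3 * r) by positivity)
    (show 0 ≤ 1 - 1 / (3 * r) by
      rw [sub_nonneg, div_le_one (by positivity)]
      linarith) (by ring)
  convert this using 1
  have e : (1 / 3 : ℝ) = 1 / (3 * r) * r := by field_simp
  rw [e]
  module

theorem cuspKernel_eq {p q x y h : ℝ} (hh : h = x * p + y * q) (h0 : 0 < h) :
    cuspKernel p q x y = √(p * q * (p + q)) / (h * √h) := by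
  have e : h ^ (-3 / 2 : ℝ) = (h * √h)⁻¹ := by
    rw [Real.sqrt_eq_rpow, ← Real.rpow_one_add' h0.le (by norm_num), ← Real.rpow_neg h0.le]
    norm_num
  rw [cuspKernel, ← hh, e, div_eq_mul_inv]

/-- In the third of an ideal triangle next to the vertex `a`, the symmetric part of the domain
contains two vectors spanning a large area. -/
theorem IsPinched.exists_mem_symmetricPart {C : Set E} (hC : Convex ℝ C) (hCo : IsOpen C)
    {K : ℝ} (hK : 1 ≤ K) {a b c : E} {N : E →L[ℝ] ℝ} (hN : IsPinched C 1 K a N)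
    (hb : b ∈ closure C) (hc : c ∈ closure C) (hab : b ≠ a) (hac : c ≠ a)
    (hT : openTriangle a b c ⊆ C) :
    ∃ p q : ℝ, 0 < p ∧ 0 < q ∧ ∀ β γ : ℝ, 0 < β → 0 < γ → β + γ ≤ 2 / 3 →
      ∃ y₁ z₁ y₂ z₂ : ℝ,
        y₁ • (b - a) + z₁ • (c - a) ∈ symmetricPart C (a + β • (b - a) + γ • (c - a)) ∧
        y₂ • (b - a) + z₂ • (c - a) ∈ symmetricPart C (a + β • (b - a) + γ • (c - a)) ∧
        1 = 144 * K * |y₁ * z₂ - z₁ * y₂| * cuspKernel p q β γ := by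
  set p := N (b - a) with hp
  set q := N (c - a) with hq
  have hbp : ‖b - a‖ ^ 2 ≤ p := by simpa only [one_mul] using hN.1 b hb
  have hcq : ‖c - a‖ ^ 2 ≤ q := by simpa only [one_mul] using hN.1 c hc
  have hp0 : 0 < p := (pow_pos (norm_pos_iff.2 (sub_ne_zero.2 hab)) 2).trans_le hbp
  have hq0 : 0 < q := (pow_pos (norm_pos_iff.2 (sub_ne_zero.2 hac)) 2).trans_le hcq
  refine ⟨p, q, hp0, hq0, fun β γ hβ hγ hσ => ?_⟩
  set h := β * p + γ * q with hh
  have hh0 : 0 < h := by positivity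
  have hm : 0 < p * q * (p + q) := by positivity
  have hK0 : 0 < K := by linarith
  set m := √(p * q * (p + q)) with hmdef
  have hm0 : 0 < m := Real.sqrt_pos.2 hm
  have hm2 : m ^ 2 = p * q * (p + q) := Real.sq_sqrt hm.le
  set w := β • (b - a) + γ • (c - a) with hw
  have hx : a + β • (b - a) + γ • (c - a) = a + w := by rw [hw, add_assoc]
  rw [hx]
  have hNw : N w = h := by simp [hw, hh, ← hp, ← hq]
  -- points of the triangle on the half-line from `a` through `a + w`
  have hray : ∀ θ : ℝ, 0 < θ → θ * (β + γ) < 1 → a + θ • w ∈ C := fun θ hθ hθ1 => by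
    refine hT ⟨1 - θ * (β + γ), θ * β, θ * γ, by linarith, by positivity, by positivity, by ring, ?_⟩
    rw [hw]; module
  have hwn : ‖w‖ ^ 2 ≤ h := by
    have h1 : β * ‖b - a‖ ^ 2 + γ * ‖c - a‖ ^ 2 ≤ h := by rw [hh]; gcongr
    calc ‖w‖ ^ 2 ≤ (β + γ) * (β * ‖b - a‖ ^ 2 + γ * ‖c - a‖ ^ 2) :=
          norm_smul_add_smul_sq_le hβ.le hγ.le _ _
      _ ≤ 1 * h := by gcongr; linarith
      _ = h := one_mul h
  -- The direction of the triangle's plane that is tangent to the boundary at `a`.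
  set τ := q • (b - a) - p • (c - a) with hτ
  have hNτ : N τ = 0 := by
    rw [hτ, map_sub, map_smul, map_smul, ← hp, ← hq, smul_eq_mul, smul_eq_mul, mul_comm, sub_self]
  have hτn : ‖τ‖ ^ 2 ≤ 2 * m ^ 2 := by
    have h1 := norm_add_sq_le_two_mul (q • (b - a)) (-(p • (c - a)))
    rw [← sub_eq_add_neg, ← hτ, norm_neg, norm_smul, norm_smul, mul_pow, mul_pow,
      Real.norm_eq_abs, Real.norm_eq_abs, sq_abs, sq_abs] at h1
    have h2 : q ^ 2 * ‖b - a‖ ^ 2 ≤ q ^ 2 * p := by gcongr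
    have h3 : p ^ 2 * ‖c - a‖ ^ 2 ≤ p ^ 2 * q := by gcongr
    rw [hm2]
    linarith
  -- Chosen so that `a + (1 / (8 * K)) • w ± s • τ` satisfies the inner paraboloid inequality.
  set s := √h / (12 * K * m) with hs
  have hs0 : 0 < s := by positivity
  have hs2 : s ^ 2 * m ^ 2 = h / (144 * K ^ 2) := by
    rw [hs, div_pow, Real.sq_sqrt hh0.le]
    field_simp
    norm_num
  -- tangential displacement close to `a`
  have hnear : ∀ δ : ℝ, δ ^ 2 = 1 → a + (1 / (8 * K)) • w + (δ * s) • τ ∈ C := fun δ hδ => by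
    refine hN.2 _ ?_
    rw [add_assoc, add_sub_cancel_left, map_add, map_smul, map_smul, hNw, hNτ, smul_zero, add_zero,
      smul_eq_mul]
    exact mul_norm_sq_lt_of_tangential hK0 hh0 hwn hτn (by rw [mul_pow, hδ, one_mul, hs2])
  have hxC : a + w ∈ C := by simpa using hray 1 one_pos (by linarith)
  have hfar : a + (1 / (β + γ)) • w ∈ closure C := by
    have h0 : 0 < β + γ := by positivity
    have := hC.closure hb hc (show 0 ≤ β / (β + γ) by positivity)
      (show 0 ≤ γ / (β + γ) by positivity) (by field_simp)
    convert this using 1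
    have e : a = (β / (β + γ)) • a + (γ / (β + γ)) • a := by
      rw [← add_smul, ← add_div, div_self h0.ne', one_smul]
    nth_rewrite 1 [e]
    rw [hw]
    module
  have hmid : ∀ δ : ℝ, δ ^ 2 = 1 → a + w + (1 / 3 : ℝ) • (δ * s) • τ ∈ C := fun δ hδ =>
    add_third_smul_mem hC hCo (show 0 < 1 / (8 * K) by positivity)
      (by rw [div_le_one (by positivity)]; linarith) (by positivity) hσ (hnear δ hδ) hfar hxC
  -- The vectors are `w / 4`, admissible since `5 / 4 * (2 / 3) < 1`, and `(s / 3) • τ`, carried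
  -- from near `a` by the homothety. Their determinant has absolute value `s * h / 12`.
  refine ⟨β / 4, γ / 4, s / 3 * q, -(s / 3 * p), ⟨?_, ?_⟩, ⟨?_, ?_⟩, ?_⟩
  · convert hray (5 / 4) (by norm_num) (by linarith) using 1
    rw [hw]; module
  · convert hray (3 / 4) (by norm_num) (by linarith) using 1
    rw [hw]; module
  · convert hmid 1 (by norm_num) using 1
    rw [hτ]; module
  · convert hmid (-1) (by norm_num) using 1
    rw [hτ]; module
  · have e1 : β / 4 * -(s / 3 * p) - γ / 4 * (s / 3 * q) = -(s * h / 12) := by rw [hh]; ring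
    have hsh : 0 < √h := Real.sqrt_pos.2 hh0
    rw [e1, abs_neg, abs_of_pos (by positivity), cuspKernel_eq hh hh0, ← hmdef, hs]
    field_simp
    norm_num

end Triangle

/-! ### Combining the three vertices -/

section Triangle

variable {E : Type*} [NormedAddCommGroup E] [InnerProductSpace ℝ E]

theorem openTriangle_rotate (a b c : E) : openTriangle b c a = openTriangle a b c := by
  ext x
  constructor
  · rintro ⟨r, s, t, hr, hs, ht, h1, rfl⟩
    exact ⟨t, r, s, ht, hr, hs, by linarith, by abel⟩
  · rintro ⟨r, s, t, hr, hs, ht, h1, rfl⟩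
    exact ⟨s, t, r, hs, ht, hr, by linarith, by abel⟩

theorem one_le_mul_cuspFun {d p q x y : ℝ} (hp : 0 < p) (hq : 0 < q) (hx : 0 < x) (hy : 0 < y)
    (hxy : x + y ≤ 2 / 3) (h : 1 = d * cuspKernel p q x y) :
    1 ≤ ENNReal.ofReal d * cuspFun p q (x, y) := by
  have hmem : (x, y) ∈ Set.Ioc (0 : ℝ) 1 ×ˢ Set.Ioc (0 : ℝ) 1 :=
    ⟨⟨hx, by simp only; linarith⟩, ⟨hy, by simp only; linarith⟩⟩
  rw [cuspFun, Set.indicator_of_mem hmem, ← ENNReal.ofReal_mul' (cuspKernel_pos hp hq hx hy).le,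
    ← h, ENNReal.ofReal_one]

/-- The symmetric part of the domain at a point of an ideal triangle contains two vectors which
span a large area: the inverse of this area is bounded, in barycentric coordinates, by a function
with a universally bounded integral. -/
theorem IsIdealTriangle.exists_mem_symmetricPart {C : Set E} (hC : IsConvexDomain C)
    {K : ℝ} (hK : 1 ≤ K) (hN : ∀ a ∈ frontier C, ∃ N, IsPinched C 1 K a N) {a b c : E}
    (hT : IsIdealTriangle C a b c) :
    ∃ G : ℝ × ℝ → ENNReal, ∫⁻ z, G z ≤ ENNReal.ofReal 18 ∧
      ∀ β γ : ℝ, 0 < β → 0 < γ → β + γ < 1 → ∃ y₁ z₁ y₂ z₂ : ℝ,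
        y₁ • (b - a) + z₁ • (c - a) ∈ symmetricPart C (a + β • (b - a) + γ • (c - a)) ∧
        y₂ • (b - a) + z₂ • (c - a) ∈ symmetricPart C (a + β • (b - a) + γ • (c - a)) ∧
        1 ≤ ENNReal.ofReal (144 * K * |y₁ * z₂ - z₁ * y₂|) * G (β, γ) := by
  have hinj := hT.affineIndependent.injective
  have hba : b ≠ a := fun h => by simpa using hinj (a₁ := 1) (a₂ := 0) h
  have hca : c ≠ a := fun h => by simpa using hinj (a₁ := 2) (a₂ := 0) h
  have hcb : c ≠ b := fun h => by simpa using hinj (a₁ := 2) (a₂ := 1) h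
  have ha := frontier_subset_closure hT.mem_frontier₁
  have hb := frontier_subset_closure hT.mem_frontier₂
  have hc := frontier_subset_closure hT.mem_frontier₃
  obtain ⟨N₁, hN₁⟩ := hN a hT.mem_frontier₁
  obtain ⟨N₂, hN₂⟩ := hN b hT.mem_frontier₂
  obtain ⟨N₃, hN₃⟩ := hN c hT.mem_frontier₃
  obtain ⟨p₁, q₁, hp₁, hq₁, h₁⟩ := hN₁.exists_mem_symmetricPart hC.convex hC.isOpen hK hb hc
    hba hca hT.subset
  obtain ⟨p₂, q₂, hp₂, hq₂, h₂⟩ := hN₂.exists_mem_symmetricPart hC.convex hC.isOpen hK hc ha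
    hcb hba.symm (by rw [openTriangle_rotate]; exact hT.subset)
  obtain ⟨p₃, q₃, hp₃, hq₃, h₃⟩ := hN₃.exists_mem_symmetricPart hC.convex hC.isOpen hK ha hb
    hca.symm hcb.symm (by rw [openTriangle_rotate, openTriangle_rotate]; exact hT.subset)
  refine ⟨fun z => cuspFun p₁ q₁ z + (cuspFun p₂ q₂ (z.2, 1 - z.1 - z.2) +
    cuspFun p₃ q₃ (1 - z.1 - z.2, z.1)), ?_, fun β γ hβ hγ hβγ => ?_⟩
  · have hm := measurable_cuspFun p₂ q₂
    rw [lintegral_add_left (measurable_cuspFun p₁ q₁), lintegral_add_left (by fun_prop),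
      lintegral_cuspFun_shear₁, lintegral_cuspFun_shear₂]
    calc _ ≤ ENNReal.ofReal 6 + (ENNReal.ofReal 6 + ENNReal.ofReal 6) :=
          add_le_add (lintegral_cuspFun_le hp₁ hq₁)
            (add_le_add (lintegral_cuspFun_le hp₂ hq₂) (lintegral_cuspFun_le hp₃ hq₃))
      _ = ENNReal.ofReal 18 := by
        rw [← ENNReal.ofReal_add (by norm_num) (by norm_num),
          ← ENNReal.ofReal_add (by norm_num) (by norm_num)]
        norm_num
  · have hα : 0 < 1 - β - γ := by linarith
    -- Some barycentric coordinate is at least `1 / 3`; the estimate at the corresponding vertex is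
    -- used.
    by_cases c₁ : β + γ ≤ 2 / 3
    · obtain ⟨y₁, z₁, y₂, z₂, e₁, e₂, hd⟩ := h₁ β γ hβ hγ c₁
      exact ⟨y₁, z₁, y₂, z₂, e₁, e₂, (one_le_mul_cuspFun hp₁ hq₁ hβ hγ c₁ hd).trans
        (mul_le_mul_right le_self_add _)⟩
    · by_cases c₂ : γ + (1 - β - γ) ≤ 2 / 3
      · obtain ⟨y₁, z₁, y₂, z₂, e₁, e₂, hd⟩ := h₂ γ (1 - β - γ) hγ hα c₂
        have ex : b + γ • (c - b) + (1 - β - γ) • (a - b) = a + β • (b - a) + γ • (c - a) := by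
          module
        rw [ex] at e₁ e₂
        refine ⟨-(y₁ + z₁), y₁, -(y₂ + z₂), y₂, ?_, ?_, ?_⟩
        · convert e₁ using 1; module
        · convert e₂ using 1; module
        · refine (one_le_mul_cuspFun hp₂ hq₂ hγ hα c₂ hd).trans (mul_le_mul' (le_of_eq ?_)
            (le_self_add.trans le_add_self))
          congr 3; ring
      · have c₃ : (1 - β - γ) + β ≤ 2 / 3 := by linarith
        obtain ⟨y₁, z₁, y₂, z₂, e₁, e₂, hd⟩ := h₃ (1 - β - γ) β hα hβ c₃
        have ex : c + (1 - β - γ) • (a - c) + β • (b - c) = a + β • (b - a) + γ • (c - a) := by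
          module
        rw [ex] at e₁ e₂
        refine ⟨z₁, -(y₁ + z₁), z₂, -(y₂ + z₂), ?_, ?_, ?_⟩
        · convert e₁ using 1; module
        · convert e₂ using 1; module
        · refine (one_le_mul_cuspFun hp₃ hq₃ hα hβ c₃ hd).trans (mul_le_mul' (le_of_eq ?_)
            (le_add_self.trans le_add_self))
          congr 3; ring

end Triangle

/-! ### Unit balls and the Hilbert density in linear coordinates -/

section Density

theorem ofReal_abs_det_le_volume {S : Set (Fin 2 → ℝ)} (u v : Fin 2 → ℝ)
    (h : ∀ s t : ℝ, |s| ≤ 1 / 2 → |t| ≤ 1 / 2 → s • u + t • v ∈ S) :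
    ENNReal.ofReal |u 0 * v 1 - u 1 * v 0| ≤ volume S := by
  set A : Matrix (Fin 2) (Fin 2) ℝ := !![u 0, v 0; u 1, v 1]
  set box : Set (Fin 2 → ℝ) := Set.univ.pi fun _ => Set.Icc (-(1 / 2)) (1 / 2)
  have hbox : volume box = 1 := by
    rw [volume_pi_pi]
    simp only [Real.volume_Icc, Finset.prod_const]
    norm_num
  have hsub : A.toLin' '' box ⊆ S := by
    rintro _ ⟨w, hw, rfl⟩
    have := h (w 0) (w 1) (abs_le.2 (hw 0 trivial)) (abs_le.2 (hw 1 trivial))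
    convert this using 1
    ext i
    fin_cases i <;> simp [A, Matrix.mulVec, dotProduct, Fin.sum_univ_two] <;> ring
  refine le_trans (le_of_eq ?_) (measure_mono hsub)
  rw [Measure.addHaar_image_linearMap, hbox, mul_one, LinearMap.det_toLin', Matrix.det_fin_two_of]
  congr 2
  ring

variable {V : Type*} [NormedAddCommGroup V] [InnerProductSpace ℝ V]

/-- As `D` is open, the line leaves it strictly beyond `x + v` and `x - v`, so both reciprocals in
the Finsler norm are less than `1 / ‖v‖`. -/
theorem symmetricPart_subset_unitBall {D : Set V} (hDo : IsOpen D) (hDb : Bornology.IsBounded D)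
    (x : V) : symmetricPart D x ⊆ unitBall D x := by
  rintro v ⟨h1, h2⟩
  rcases eq_or_ne v 0 with rfl | hv
  · simp [unitBall, finsler]
  have hv0 : 0 < ‖v‖ := norm_pos_iff.2 hv
  have key : ∀ w : V, ‖w‖ = ‖v‖ → x + w ∈ D → ‖v‖ < ‖x - exitPoint D x w‖ := fun w hw hx => by
    have hw0 : 0 < ‖w‖ := hw ▸ hv0
    have hbdd : BddAbove {t : ℝ | x + t • w ∈ D} := by
      obtain ⟨R, hR⟩ := hDb.exists_norm_le
      refine ⟨(R + ‖x‖) / ‖w‖, fun t ht => ?_⟩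
      rw [le_div_iff₀ hw0]
      calc t * ‖w‖ ≤ ‖t • w‖ := by
            rw [norm_smul]; exact mul_le_mul_of_nonneg_right (le_abs_self t) (norm_nonneg _)
        _ = ‖(x + t • w) - x‖ := by rw [add_sub_cancel_left]
        _ ≤ ‖x + t • w‖ + ‖x‖ := norm_sub_le _ _
        _ ≤ R + ‖x‖ := by gcongr; exact hR _ ht
    obtain ⟨t, ht, ht1⟩ : ∃ t : ℝ, x + t • w ∈ D ∧ 1 < t := by
      have hcont : ContinuousAt (fun t : ℝ => x + t • w) 1 := by fun_prop
      have h1 : ∀ᶠ t : ℝ in 𝓝[>] 1, x + t • w ∈ D := nhdsWithin_le_nhds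
        (hcont.preimage_mem_nhds (hDo.mem_nhds (by simpa using hx)))
      exact (h1.and self_mem_nhdsWithin).exists
    have hs : 1 < sSup {t : ℝ | x + t • w ∈ D} := ht1.trans_le (le_csSup hbdd ht)
    rw [exitPoint, sub_add_cancel_left, norm_neg, norm_smul, Real.norm_of_nonneg (by linarith),
      ← hw]
    nlinarith
  have e1 := one_div_lt_one_div_of_lt hv0 (key v rfl h1)
  have e2 := one_div_lt_one_div_of_lt hv0 (key (-v) (norm_neg v) (by rwa [← sub_eq_add_neg]))
  change 1 / 2 * ‖v‖ * _ < 1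
  calc 1 / 2 * ‖v‖ * (1 / ‖x - exitPoint D x (-v)‖ + 1 / ‖x - exitPoint D x v‖)
      < 1 / 2 * ‖v‖ * (1 / ‖v‖ + 1 / ‖v‖) := by gcongr
    _ = 1 := by field_simp; norm_num

variable [FiniteDimensional ℝ V] [MeasurableSpace V] [BorelSpace V]

/-- Computation of the Hilbert area in linear coordinates. -/
theorem hilbertMeasure_le_lintegral (hV : Module.finrank ℝ V = 2) (Φ : (Fin 2 → ℝ) ≃L[ℝ] V)
    (D : Set V) {T : Set V} (hT : MeasurableSet T) (g : (Fin 2 → ℝ) → ENNReal)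
    (hg : ∀ u, Φ u ∈ T → ENNReal.ofReal Real.pi ≤ g u * volume (Φ ⁻¹' unitBall D (Φ u))) :
    hilbertMeasure D T ≤ ∫⁻ u, g u := by
  set e := Φ.toHomeomorph.toMeasurableEquiv
  set μ : Measure V := Measure.map e volume with hμ
  have : μ.IsAddHaarMeasure := Φ.isAddHaarMeasure_map volume
  -- `J` is the Jacobian of the chart. It multiplies both the area element and the area of the unit
  -- ball, so it cancels.
  obtain ⟨J, hJ0, hJ⟩ : ∃ J : NNReal, J ≠ 0 ∧ (volume : Measure V) = J • μ :=
    ⟨_, (Measure.addHaarScalarFactor_pos_of_isAddHaarMeasure volume μ).ne',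
      Measure.isAddLeftInvariant_eq_smul _ _⟩
  have hJ' : (J : ENNReal) ≠ 0 := ENNReal.coe_ne_zero.2 hJ0
  have : Nontrivial V := Module.nontrivial_of_finrank_pos (R := ℝ) (by omega)
  have hball : (volume : Measure V) (ball 0 1) = ENNReal.ofReal Real.pi := by
    rw [InnerProductSpace.volume_ball_of_dim_even (k := 1) (by omega)]
    simp
  have hdens : ∀ u, Φ u ∈ T → J * density D (Φ u) ≤ g u := fun u hu => by
    have h1 : (volume : Measure V) (unitBall D (Φ u)) =
        J * volume (Φ ⁻¹' unitBall D (Φ u)) := by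
      rw [hJ, Measure.smul_apply, hμ, e.map_apply]; rfl
    rw [density, hball, h1]
    have h2 : ENNReal.ofReal Real.pi / (J * volume (Φ ⁻¹' unitBall D (Φ u))) ≤ g u / J := by
      refine ENNReal.div_le_of_le_mul ((hg u hu).trans (le_of_eq ?_))
      rw [← mul_assoc, ENNReal.div_mul_cancel hJ' ENNReal.coe_ne_top]
    calc _ ≤ J * (g u / J) := mul_le_mul_right h2 _
      _ = g u := ENNReal.mul_div_cancel hJ' ENNReal.coe_ne_top
  calc hilbertMeasure D T = ∫⁻ v in T, density D v ∂(volume.restrict D) :=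
        withDensity_apply _ hT
    _ ≤ ∫⁻ v in T, density D v := lintegral_mono' (Measure.restrict_mono le_rfl
        Measure.restrict_le_self) le_rfl
    _ = J * ∫⁻ u, T.indicator (density D) (Φ u) := by
      rw [← lintegral_indicator hT, hJ, lintegral_smul_measure, hμ, lintegral_map_equiv]
      rfl
    _ = ∫⁻ u, J * T.indicator (density D) (Φ u) :=
      (lintegral_const_mul' _ _ ENNReal.coe_ne_top).symm
    _ ≤ ∫⁻ u, g u := lintegral_mono fun u => by
      by_cases hu : Φ u ∈ T
      · simpa [hu] using hdens u hu
      · simp [hu]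

end Density

/-! ### The plane of the triangle and the final bound -/

section Plane

variable {E : Type*} [NormedAddCommGroup E] [InnerProductSpace ℝ E]

theorem finrank_vectorSpan_triple {a b c : E} (h : AffineIndependent ℝ ![a, b, c]) :
    Module.finrank ℝ (vectorSpan ℝ ({a, b, c} : Set E)) = 2 := by
  have := h.finrank_vectorSpan (n := 2) (by simp)
  rwa [show Set.range ![a, b, c] = {a, b, c} by
    ext x
    simp [Matrix.range_cons]
    tauto] at this

/-- Linear coordinates on the direction of the plane of a triangle. -/
theorem exists_coordinates {a b c : E} (h : AffineIndependent ℝ ![a, b, c]) :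
    ∃ Φ : (Fin 2 → ℝ) ≃L[ℝ] vectorSpan ℝ ({a, b, c} : Set E),
      ∀ u, (Φ u : E) = u 0 • (b - a) + u 1 • (c - a) := by
  have hb : b - a ∈ vectorSpan ℝ ({a, b, c} : Set E) :=
    vsub_mem_vectorSpan ℝ (by simp) (by simp)
  have hc : c - a ∈ vectorSpan ℝ ({a, b, c} : Set E) :=
    vsub_mem_vectorSpan ℝ (by simp) (by simp)
  have hli : LinearIndependent ℝ ![(⟨b - a, hb⟩ : vectorSpan ℝ ({a, b, c} : Set E)),
      ⟨c - a, hc⟩] := by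
    rw [LinearIndependent.pair_iff]
    intro s t hst
    have hst' : s • (b - a) + t • (c - a) = 0 := congrArg Subtype.val hst
    have := affineIndependent_iff.1 h Finset.univ ![-s - t, s, t]
      (by simp [Fin.sum_univ_three]; ring)
      (by
        rw [← hst']
        simp only [Fin.sum_univ_three, Matrix.cons_val]
        module)
    exact ⟨by simpa using this 1 (Finset.mem_univ _), by simpa using this 2 (Finset.mem_univ _)⟩
  have : FiniteDimensional ℝ (vectorSpan ℝ ({a, b, c} : Set E)) :=
    FiniteDimensional.of_finrank_pos (by rw [finrank_vectorSpan_triple h]; norm_num)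
  let B := basisOfLinearIndependentOfCardEqFinrank hli (by
    rw [finrank_vectorSpan_triple h, Fintype.card_fin])
  refine ⟨B.equivFun.symm.toContinuousLinearEquiv, fun u => ?_⟩
  have : B.equivFun.symm u = u 0 • (⟨b - a, hb⟩ : vectorSpan ℝ ({a, b, c} : Set E)) +
      u 1 • ⟨c - a, hc⟩ := by
    rw [Module.Basis.equivFun_symm_apply, Fin.sum_univ_two]
    simp [B]
  exact congrArg Subtype.val this

theorem mem_planeSection_openTriangle_iff {a b c : E}
    {Φ : (Fin 2 → ℝ) ≃L[ℝ] vectorSpan ℝ ({a, b, c} : Set E)}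
    (hΦ : ∀ u, (Φ u : E) = u 0 • (b - a) + u 1 • (c - a)) (u : Fin 2 → ℝ) :
    Φ u ∈ planeSection a b c (openTriangle a b c) ↔ 0 < u 0 ∧ 0 < u 1 ∧ u 0 + u 1 < 1 := by
  constructor
  · rintro ⟨r, s, t, hr, hs, ht, h1, hx⟩
    have : Φ u = Φ ![s, t] := by
      apply Subtype.ext
      have e : a = r • a + s • a + t • a := by rw [← add_smul, ← add_smul, h1, one_smul]
      rw [hΦ ![s, t]]
      have : (Φ u : E) = r • a + s • b + t • c - a := by rw [← hx, add_sub_cancel_left]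
      rw [this]
      nth_rewrite 2 [e]
      simp only [Matrix.cons_val_zero, Matrix.cons_val_one]
      module
    rw [Φ.injective this]
    simp only [Matrix.cons_val_zero, Matrix.cons_val_one]
    exact ⟨hs, ht, by linarith⟩
  · rintro ⟨h0, h1, h2⟩
    refine ⟨1 - u 0 - u 1, u 0, u 1, by linarith, h0, h1, by ring, ?_⟩
    rw [hΦ]
    module

theorem IsIdealTriangle.triangleArea_le [FiniteDimensional ℝ E] [MeasurableSpace E] [BorelSpace E]
    {C : Set E} (hC : IsConvexDomain C) {K : ℝ} (hK : 1 ≤ K)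
    (hN : ∀ a ∈ frontier C, ∃ N, IsPinched C 1 K a N) {a b c : E}
    (hT : IsIdealTriangle C a b c) :
    triangleArea C a b c ≤ ENNReal.ofReal (Real.pi * (144 * K) * 18) := by
  obtain ⟨G, hG, hG'⟩ := hT.exists_mem_symmetricPart hC hK hN
  obtain ⟨Φ, hΦ⟩ := exists_coordinates hT.affineIndependent
  have hmem := mem_planeSection_openTriangle_iff hΦ
  have hmeas : MeasurableSet (planeSection a b c (openTriangle a b c)) := by
    have : planeSection a b c (openTriangle a b c) =
        {v | 0 < Φ.symm v 0 ∧ 0 < Φ.symm v 1 ∧ Φ.symm v 0 + Φ.symm v 1 < 1} := by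
      ext v
      have := hmem (Φ.symm v)
      rwa [Φ.apply_symm_apply] at this
    rw [this]
    have h0 : Continuous fun v => Φ.symm v 0 := (continuous_apply 0).comp Φ.symm.continuous
    have h1 : Continuous fun v => Φ.symm v 1 := (continuous_apply 1).comp Φ.symm.continuous
    exact ((isOpen_lt continuous_const h0).inter ((isOpen_lt continuous_const h1).inter
      (isOpen_lt (h0.add h1) continuous_const))).measurableSet
  have hDo : IsOpen (planeSection a b c C) :=
    hC.isOpen.preimage (continuous_const.add continuous_subtype_val)
  have hDb : Bornology.IsBounded (planeSection a b c C) := by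
    obtain ⟨R, hR⟩ := hC.isBounded.exists_norm_le
    refine isBounded_iff_forall_norm_le.2 ⟨R + ‖a‖, fun v hv => ?_⟩
    calc ‖v‖ = ‖(a + (v : E)) - a‖ := by rw [add_sub_cancel_left]; rfl
      _ ≤ ‖a + (v : E)‖ + ‖a‖ := norm_sub_le _ _
      _ ≤ R + ‖a‖ := by gcongr; exact hR _ hv
  refine (hilbertMeasure_le_lintegral (finrank_vectorSpan_triple hT.affineIndependent) Φ
    (planeSection a b c C) hmeas
    (fun u => ENNReal.ofReal (Real.pi * (144 * K)) * G (u 0, u 1)) fun u hu => ?_).trans ?_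
  · obtain ⟨h0, h1, h2⟩ := (hmem u).1 hu
    obtain ⟨y₁, z₁, y₂, z₂, e₁, e₂, hd⟩ := hG' (u 0) (u 1) h0 h1 h2
    -- By convexity and symmetry, the unit ball contains the parallelogram of half-width
    -- coefficients `|s|, |t| ≤ 1 / 2`, whose area is exactly the determinant.
    have hvol := ofReal_abs_det_le_volume (S := Φ ⁻¹' unitBall (planeSection a b c C) (Φ u))
      ![y₁, z₁] ![y₂, z₂] fun s t hs ht => by
        apply symmetricPart_subset_unitBall hDo hDb
        have := add_smul_mem_symmetricPart hC.convex e₁ e₂ hs ht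
        have e : (Φ (s • ![y₁, z₁] + t • ![y₂, z₂]) : E) =
            s • (y₁ • (b - a) + z₁ • (c - a)) + t • (y₂ • (b - a) + z₂ • (c - a)) := by
          rw [hΦ]
          simp only [Pi.add_apply, Pi.smul_apply, smul_eq_mul, Matrix.cons_val_zero,
            Matrix.cons_val_one]
          module
        rw [add_assoc, ← hΦ, ← e] at this
        exact ⟨by simpa [planeSection, add_assoc] using this.1,
          by simpa [planeSection, add_sub_assoc] using this.2⟩
    simp only [Matrix.cons_val_zero, Matrix.cons_val_one] at hvol
    calc ENNReal.ofReal Real.pi = ENNReal.ofReal Real.pi * 1 := (mul_one _).symm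
      _ ≤ ENNReal.ofReal Real.pi * (ENNReal.ofReal (144 * K * |y₁ * z₂ - z₁ * y₂|) *
          G (u 0, u 1)) := mul_le_mul_right hd _
      _ = ENNReal.ofReal (Real.pi * (144 * K)) * G (u 0, u 1) *
          ENNReal.ofReal |y₁ * z₂ - z₁ * y₂| := by
        rw [ENNReal.ofReal_mul (by positivity : (0 : ℝ) ≤ 144 * K),
          ENNReal.ofReal_mul Real.pi_pos.le]
        ring
      _ ≤ _ := mul_le_mul_right hvol _
  · rw [lintegral_const_mul' _ _ ENNReal.ofReal_ne_top,
      ENNReal.ofReal_mul (by positivity : 0 ≤ Real.pi * (144 * K))]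
    refine mul_le_mul_right (le_of_eq_of_le ?_ hG) _
    exact (volume_preserving_finTwoArrow ℝ).lintegral_comp_emb
      (MeasurableEquiv.finTwoArrow.measurableEmbedding) G

end Plane

end HilbertGeometry

theorem mainTheorem3 (n : ℕ) (C : Set (EuclideanSpace ℝ (Fin n)))
    (hC : HilbertGeometry.IsStrictlyConvexDomain C) :
    ∃ α : ℝ, 0 < α ∧ ∀ a b c : EuclideanSpace ℝ (Fin n),
      HilbertGeometry.IsIdealTriangle C a b c →
        HilbertGeometry.triangleArea C a b c ≤ ENNReal.ofReal α := by
  obtain ⟨K, hK, hN⟩ := hC.exists_isPinched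
  exact ⟨Real.pi * (144 * K) * 18, by positivity, fun a b c hT =>
    hT.triangleArea_le hC.toIsConvexDomain hK hN⟩
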